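/- \textbf{Setting.} Let $d,k\ge 0$, $n,T\ge 1$ be integers, $\mathcal X\subseteq\mathbb R^d$, $\mathcal Y\subseteq\mathbb R$, $\mathcal Z=\mathcal X\times\mathcal Y$, and let $\mathcal S$ be a measurable space (of side information). Let $\ell:\mathbb R\times\mathbb R\to\mathbb R$ be a measurable loss such that, for some $L>0$ and every $y\in\mathcal Y$, $\ell(\cdot,y)$ is convex and $L$-Lipschitz; let $R>0$ with $\|x\|\le R$ for all $x\in\mathcal X$. Let $\Phi:\mathcal S\to\mathbb R^k$ be measurable with $\|\Phi(s)\|\le K$ for all $s\in\mathcal S$, where $K>0$. Let $\rho$ be a probability distribution of pairs $(\mu,s)$, where $\mu$ (a task) is a probability distribution on $\mathcal Z$ and $s\in\mathcal S$. For a task $\mu$ write $\mathcal R_\mu(w)=\mathbb E_{(x,y)\sim\mu}\,\ell(\langle x,w\rangle,y)$. Assume that for $\rho$-almost every $(\mu,s)$ these risks are finite (the loss is $\mu$-integrable for every $w\in\mathbb R^d$) and $w_\mu\in\operatorname{argmin}_{w\in\mathbb R^d}\mathcal R_\mu(w)$ is a minimizer, and that $\mathcal E^*_\rho=\mathbb E_{(\mu,s)\sim\rho}\,\mathcal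 R_\mu(w_\mu)$ exists and is finite. For $\lambda>0$, $\theta\in\mathbb R^d$ and a dataset $Z=(x_i,y_i)_{i=1}^n\in\mathcal Z^n$ let $$A(\theta,Z)=\operatorname*{argmin}_{w\in\mathbb R^d}\ \frac1n\sum_{i=1}^n\ell(\langle x_i,w\rangle,y_i)+\frac\lambda2\|w-\theta\|^2 ,$$ and for measurable $\tau:\mathcal S\to\mathbb R^d$ let $$\mathcal E_\rho(\tau)=\mathbb E_{(\mu,s)\sim\rho}\,\mathbb E_{Z\sim\mu^n}\,\mathcal R_\mu\big(A(\tau(s),Z)\big),\qquad \mathrm{Var}_\rho(\tau)=\Big(\mathbb E_{(\mu,s)\sim\rho}\|w_\mu-\tau(s)\|^2\Big)^{1/2}.$$ For $M\in\mathbb R^{d\times k}$, $b\in\mathbb R^d$ let $\tau_{M,b}(s)=M\Phi(s)+b$ and $\|(M,b)\|_F^2=\|M\|_F^2+\|b\|^2$. \textbf{Algorithm.} Given $\lambda>0$, $\gamma\ge0$ and pairs $(Z_t,s_t)_{t=1}^T$, put $M_1=0$, $b_1=0$ and, for $t=1,\dots,T$, with $\theta_t=M_t\Phi(s_t)+b_t$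 and $w_t=A(\theta_t,Z_t)$, $$M_{t+1}=M_t+\gamma\lambda\,(w_t-\theta_t)\Phi(s_t)^\top,\qquad b_{t+1}=b_t+\gamma\lambda\,(w_t-\theta_t).$$ Return $\bar M=\frac1T\sum_{t=1}^TM_t$ and $\bar b=\frac1T\sum_{t=1}^Tb_t$. \textbf{Theorem.} Fix $M\in\mathbb R^{d\times k}$ and $b\in\mathbb R^d$ with $0<\mathrm{Var}_\rho(\tau_{M,b})<\infty$. Let $(Z_t,s_t)_{t=1}^T$ be i.i.d., each obtained by drawing $(\mu_t,s_t)\sim\rho$ and then $Z_t\sim\mu_t^n$, and let $(\bar M,\bar b)$ be the output of the algorithm with $$\lambda=\frac{2RL}{\mathrm{Var}_\rho(\tau_{M,b})}\,\frac1{\sqrt n},\qquad \gamma=\frac{\|(M,b)\|_F}{LR\sqrt{K^2+1}}\,\frac1{\sqrt T}.$$ Then the expectations that define $\mathcal E_\rho(\tau_{\bar M,\bar b})$ (for every realization of the data) and $\mathbb E\,\mathcal E_\rho(\tau_{\bar M,\bar b})$ exist and are finite and, in expectation with respect to $(Z_t,s_t)_{t=1}^T$, $$\mathbb E\,\mathcal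 E_\rho(\tau_{\bar M,\bar b})-\mathcal E^*_\rho\ \le\ \frac{2RL\,\mathrm{Var}_\rho(\tau_{M,b})}{\sqrt n}+\frac{LR\sqrt{K^2+1}\,\|(M,b)\|_F}{\sqrt T}.$$ -/

import Mathlib

open MeasureTheory ProbabilityTheory

namespace CondMeta

noncomputable section

/-- The space of weight vectors (and of bias vectors): `ℝ^d` with the Euclidean norm. -/
abbrev Vec (d : ℕ) := EuclideanSpace ℝ (Fin d)

/-- The data space `𝒵 = 𝒳 × 𝒴`, with `𝒳 ⊆ ℝ^d` and `𝒴 ⊆ ℝ`. -/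
abbrev Datum {d : ℕ} (X : Set (Vec d)) (Y : Set ℝ) := ↥X × ↥Y

/-- A task is a probability distribution on `𝒵`. -/
abbrev LearningTask {d : ℕ} (X : Set (Vec d)) (Y : Set ℝ) := ProbabilityMeasure (Datum X Y)

/-- The loss `ℓ(⟨x, w⟩, y)` of the linear predictor `w` at the datum `z = (x, y)`. -/
def lossAt {d : ℕ} {X : Set (Vec d)} {Y : Set ℝ} (l : ℝ → ℝ → ℝ) (w : Vec d)
    (z : Datum X Y) : ℝ :=
  l (inner ℝ (z.1 : Vec d) w) z.2

/-- The expected risk `R_μ(w) = E_{(x, y) ∼ μ} ℓ(⟨x, w⟩, y)`. -/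
def risk {d : ℕ} {X : Set (Vec d)} {Y : Set ℝ} (l : ℝ → ℝ → ℝ) (μ : LearningTask X Y)
    (w : Vec d) : ℝ :=
  ∫ z, lossAt l w z ∂(μ : Measure (Datum X Y))

/-- The biased regularized empirical risk
`R_Z^λ(w) = (1/n) ∑ i, ℓ(⟨x_i, w⟩, y_i) + (λ/2) ‖w - θ‖²`. -/
def regRisk {d n : ℕ} {X : Set (Vec d)} {Y : Set ℝ} (l : ℝ → ℝ → ℝ) (lam : ℝ)
    (θ : Vec d) (Z : Fin n → Datum X Y) (w : Vec d) : ℝ :=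
  (1 / (n : ℝ)) * ∑ i, lossAt l w (Z i) + lam / 2 * ‖w - θ‖ ^ 2

/-- The inner algorithm `A(θ, Z) = argmin_w R_Z^λ(w)`. -/
def innerAlg {d n : ℕ} {X : Set (Vec d)} {Y : Set ℝ} (l : ℝ → ℝ → ℝ) (lam : ℝ)
    (θ : Vec d) (Z : Fin n → Datum X Y) : Vec d :=
  Classical.epsilon fun w => IsMinOn (regRisk l lam θ Z) Set.univ w

/-- The law `μ ↦ μ^n` of a dataset of `n` i.i.d. points depends measurably on the task. -/
lemma measurable_datasetLaw {d : ℕ} (X : Set (Vec d)) (Y : Set ℝ) {S : Type*}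
    [MeasurableSpace S] (n : ℕ) :
    Measurable fun p : LearningTask X Y × S =>
      Measure.pi fun _ : Fin n => (p.1 : Measure (Datum X Y)) := by
  apply Measurable.measure_of_isPiSystem_of_isProbabilityMeasure generateFrom_pi.symm isPiSystem_pi
  rintro _ ⟨t, ht, rfl⟩
  simp only [Measure.pi_pi]
  refine Finset.measurable_prod _ fun i _ => ?_
  exact (Measure.measurable_coe (show MeasurableSet (t i) from ht i (Set.mem_univ i))).comp
    (measurable_subtype_coe.comp measurable_fst)

/-- Given a task `μ` (and side information `s`), draw a dataset `Z ∼ μ^n`. -/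
def datasetKernel {d : ℕ} (X : Set (Vec d)) (Y : Set ℝ) (S : Type*) [MeasurableSpace S]
    (n : ℕ) : Kernel (LearningTask X Y × S) (Fin n → Datum X Y) where
  toFun p := Measure.pi fun _ : Fin n => (p.1 : Measure (Datum X Y))
  measurable' := measurable_datasetLaw X Y n

instance {d : ℕ} (X : Set (Vec d)) (Y : Set ℝ) (S : Type*) [MeasurableSpace S] (n : ℕ) :
    IsMarkovKernel (datasetKernel X Y S n) :=
  ⟨fun p => inferInstanceAs (IsProbabilityMeasure
    (Measure.pi fun _ : Fin n => (p.1 : Measure (Datum X Y))))⟩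

/-- The joint law of `((μ, s), Z)` where `(μ, s) ∼ ρ` and `Z ∼ μ^n`. -/
def episodeLaw {d : ℕ} {X : Set (Vec d)} {Y : Set ℝ} {S : Type*} [MeasurableSpace S]
    (ρ : Measure (LearningTask X Y × S)) (n : ℕ) :
    Measure ((LearningTask X Y × S) × (Fin n → Datum X Y)) :=
  ρ ⊗ₘ datasetKernel X Y S n

/-- The law of an observed pair `(Z, s)`, where `(μ, s) ∼ ρ` and `Z ∼ μ^n`. -/
def sampleLaw {d : ℕ} {X : Set (Vec d)} {Y : Set ℝ} {S : Type*} [MeasurableSpace S]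
    (ρ : Measure (LearningTask X Y × S)) (n : ℕ) : Measure ((Fin n → Datum X Y) × S) :=
  (episodeLaw ρ n).map fun q => (q.2, q.1.2)

/-- The random variable `R_μ(A(τ(s), Z))` on the space of episodes `((μ, s), Z)`. -/
def episodeRisk {d n : ℕ} {X : Set (Vec d)} {Y : Set ℝ} {S : Type*}
    (l : ℝ → ℝ → ℝ) (lam : ℝ) (τ : S → Vec d)
    (q : (LearningTask X Y × S) × (Fin n → Datum X Y)) : ℝ :=
  risk l q.1.1 (innerAlg l lam (τ q.1.2) q.2)

/-- The transfer risk `E_ρ(τ) = E_{(μ, s) ∼ ρ} E_{Z ∼ μ^n} R_μ(A(τ(s), Z))`. -/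
def transferRisk {d : ℕ} {X : Set (Vec d)} {Y : Set ℝ} {S : Type*} [MeasurableSpace S]
    (l : ℝ → ℝ → ℝ) (lam : ℝ) (ρ : Measure (LearningTask X Y × S)) (n : ℕ) (τ : S → Vec d) : ℝ :=
  ∫ q, episodeRisk l lam τ q ∂(episodeLaw ρ n)

/-- The ideal risk `E*_ρ = E_{μ ∼ ρ} R_μ(w_μ)`, for a choice `μ ↦ w_μ` of target vectors. -/
def idealRisk {d : ℕ} {X : Set (Vec d)} {Y : Set ℝ} {S : Type*} [MeasurableSpace S]
    (l : ℝ → ℝ → ℝ) (ρ : Measure (LearningTask X Y × S)) (wstar : LearningTask X Y → Vec d) : ℝ :=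
  ∫ p, risk l p.1 (wstar p.1) ∂ρ

/-- `Var_ρ(τ) = (E_{(μ, s) ∼ ρ} ‖w_μ - τ(s)‖²)^{1/2}`. -/
def stdVar {d : ℕ} {X : Set (Vec d)} {Y : Set ℝ} {S : Type*} [MeasurableSpace S]
    (ρ : Measure (LearningTask X Y × S)) (wstar : LearningTask X Y → Vec d) (τ : S → Vec d) : ℝ :=
  Real.sqrt (∫ p, ‖wstar p.1 - τ p.2‖ ^ 2 ∂ρ)

/-- Meta-parameters `(M, b) ∈ ℝ^{d × k} × ℝ^d`. -/
abbrev Params (d k : ℕ) := Matrix (Fin d) (Fin k) ℝ × Vec d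

/-- The conditioning function `τ_{M,b}(s) = M Φ(s) + b`. -/
def linCond {d k : ℕ} {S : Type*} (Φ : S → EuclideanSpace ℝ (Fin k)) (P : Params d k)
    (s : S) : Vec d :=
  Matrix.toEuclideanLin P.1 (Φ s) + P.2

/-- The norm `‖(M, b)‖_F`, where `‖(M, b)‖_F² = ‖M‖_F² + ‖b‖²`. -/
def frobNorm {d k : ℕ} (P : Params d k) : ℝ :=
  Real.sqrt (∑ i, ∑ j, P.1 i j ^ 2 + ‖P.2‖ ^ 2)

/-- The meta-gradient `-λ (A(θ, Z) - θ) (Φ(s), 1)ᵀ` at `(M, b)`, where `θ = τ_{M,b}(s)`. -/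
def metaGrad {d k n : ℕ} {X : Set (Vec d)} {Y : Set ℝ} {S : Type*} (l : ℝ → ℝ → ℝ)
    (lam : ℝ) (Φ : S → EuclideanSpace ℝ (Fin k)) (P : Params d k)
    (e : (Fin n → Datum X Y) × S) : Params d k :=
  let θ := linCond Φ P e.2
  let g : Vec d := -lam • (innerAlg l lam θ e.1 - θ)
  (Matrix.of fun i j => g i * Φ e.2 j, g)

/-- The iterates of the meta-algorithm on the data sequence `e 0, e 1, …`:
`sgdIterate … e t` is the iterate reached after `t` updates from `(0, 0)`. -/
def sgdIterate {d k n : ℕ} {X : Set (Vec d)} {Y : Set ℝ} {S : Type*} (l : ℝ → ℝ → ℝ)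
    (lam γ : ℝ) (Φ : S → EuclideanSpace ℝ (Fin k)) (e : ℕ → (Fin n → Datum X Y) × S) :
    ℕ → Params d k
  | 0 => 0
  | t + 1 => sgdIterate l lam γ Φ e t - γ • metaGrad l lam Φ (sgdIterate l lam γ Φ e t) (e t)

/-- The output `(M̄, b̄)` of the meta-algorithm: the average of its first `T` iterates. -/
def sgdOutput {d k n : ℕ} {X : Set (Vec d)} {Y : Set ℝ} {S : Type*} (l : ℝ → ℝ → ℝ)
    (lam γ : ℝ) (Φ : S → EuclideanSpace ℝ (Fin k)) (T : ℕ)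
    (e : ℕ → (Fin n → Datum X Y) × S) : Params d k :=
  (1 / (T : ℝ)) • ∑ t ∈ Finset.range T, sgdIterate l lam γ Φ e t

end

end CondMeta

open CondMeta

/-! The meta-algorithm is stochastic gradient descent on the Moreau envelope of the empirical risk.
For a dataset `Z`, the envelope is the minimal value over `w` of the regularized empirical risk,
viewed as a function of the bias `θ`. The vector `-λ (A(θ, Z) - θ)` is a subgradient of it
(`envelope_sub_le`) of norm at most `L R`. Composing with the linear map `(M, b) ↦ M Φ(s) + b`
multiplies the squared norm of the subgradient by `‖Φ(s)‖² + 1 ≤ K² + 1`.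

The excess risk splits into three parts. (1) Generalization inside a task: replacing one datum moves
`A(θ, Z)` by at most `2 L R / (λ n)`, so expected risk exceeds expected empirical risk by at most `2
(L R)² / (λ n)` (`integral_risk_sub_integral_empRisk_le`). (2) Approximation: the empirical risk at
`A(θ, Z)` is at most the envelope at `θ`. The envelope at the comparison bias `θ' = τ_{M,b}(s)` is
at most the regularized risk of `w_μ`. In expectation this contributes the ideal risk plus `λ/2 ·
Var²` (`integral_risk_le`, `transferRisk_sub_idealRisk_le`). (3) Optimization: what remains is the
difference of the envelopes at `θ` and `θ'`. The regret bound for gradient descent controls its sum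
along the iterates (`sum_envelopeDiff_le`). Independence of each iterate from the next sample,
together with Jensen's inequality, carries this to the averaged output
(`integral_envelopeDiff_sgdOutput_le`).

The prescribed `λ` equalizes the contributions of (1) and (2), and the prescribed `γ` equalizes the
two terms of the regret. -/

namespace CondMeta

open scoped RealInnerProductSpace
open Filter Topology

/-! ### Optimality of proximal points -/

section Proximal

variable {E : Type*} [NormedAddCommGroup E] [InnerProductSpace ℝ E]

/-- The first-order optimality condition for a proximal point of a convex function. -/
lemma prox_variational {φ : E → ℝ} (hφ : ConvexOn ℝ Set.univ φ) {lam : ℝ} {θ w : E}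
    (hw : IsMinOn (fun v => φ v + lam / 2 * ‖v - θ‖ ^ 2) Set.univ w) (v : E) :
    φ w - lam * ⟪w - θ, v - w⟫ ≤ φ v := by
  -- Compare `w` with the point `w + t (v - w)` of the segment, use convexity, and divide by `t`.
  -- The error is linear in `t` and vanishes as `t → 0`.
  have key : ∀ t : ℝ, 0 < t → t ≤ 1 →
      φ w - lam * ⟪w - θ, v - w⟫ - φ v ≤ t * (lam / 2 * ‖v - w‖ ^ 2) := by
    intro t ht ht1
    have h1 := hw (Set.mem_univ (w + t • (v - w)))
    have h2 := hφ.2 (Set.mem_univ w) (Set.mem_univ v) (sub_nonneg.2 ht1) ht.le (by ring)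
    have e1 : (1 - t) • w + t • v = w + t • (v - w) := by module
    have e2 : w + t • (v - w) - θ = (w - θ) + t • (v - w) := by abel
    simp only [Set.mem_ofPred_eq] at h1
    rw [e2, norm_add_sq_real, norm_smul, inner_smul_right, mul_pow, Real.norm_eq_abs, sq_abs] at h1
    rw [e1] at h2
    simp only [smul_eq_mul] at h2
    have : t * (φ w - lam * ⟪w - θ, v - w⟫ - φ v) ≤ t * (t * (lam / 2 * ‖v - w‖ ^ 2)) := by
      nlinarith
    exact le_of_mul_le_mul_left this ht
  have hlim : Tendsto (fun t : ℝ => t * (lam / 2 * ‖v - w‖ ^ 2)) (𝓝[>] 0) (𝓝 0) := by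
    have : Tendsto (fun t : ℝ => t * (lam / 2 * ‖v - w‖ ^ 2)) (𝓝 0)
        (𝓝 (0 * (lam / 2 * ‖v - w‖ ^ 2))) := (continuous_id.mul continuous_const).tendsto 0
    rw [zero_mul] at this
    exact this.mono_left nhdsWithin_le_nhds
  have := ge_of_tendsto hlim (by
    filter_upwards [Ioc_mem_nhdsGT (zero_lt_one' ℝ)] with t ht using key t ht.1 ht.2)
  linarith

end Proximal

/-! ### Deterministic properties of the inner algorithm and of its envelope -/

/-- The empirical risk of a linear predictor. -/
noncomputable def empRisk {d n : ℕ} {X : Set (Vec d)} {Y : Set ℝ} (l : ℝ → ℝ → ℝ)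
    (Z : Fin n → Datum X Y) (w : Vec d) : ℝ :=
  (1 / (n : ℝ)) * ∑ i, lossAt l w (Z i)

/-- The Moreau envelope of the empirical risk. -/
noncomputable def envelope {d n : ℕ} {X : Set (Vec d)} {Y : Set ℝ} (l : ℝ → ℝ → ℝ) (lam : ℝ)
    (θ : Vec d) (Z : Fin n → Datum X Y) : ℝ :=
  regRisk l lam θ Z (innerAlg l lam θ Z)

/-- The assumptions on the loss and on the inputs. -/
structure ConvexLipschitzLoss {d : ℕ} (X : Set (Vec d)) (Y : Set ℝ) (l : ℝ → ℝ → ℝ)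
    (L R : ℝ) : Prop where
  meas : Measurable (Function.uncurry l)
  L_pos : 0 < L
  R_pos : 0 < R
  convex : ∀ y ∈ Y, ConvexOn ℝ Set.univ (fun a => l a y)
  lipschitz : ∀ y ∈ Y, ∀ a a' : ℝ, |l a y - l a' y| ≤ L * |a - a'|
  bounded : ∀ x ∈ X, ‖x‖ ≤ R

section Deterministic

variable {d n : ℕ} {X : Set (Vec d)} {Y : Set ℝ} {l : ℝ → ℝ → ℝ} {L R lam : ℝ}

lemma regRisk_eq (θ : Vec d) (Z : Fin n → Datum X Y) (w : Vec d) :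
    regRisk l lam θ Z w = empRisk l Z w + lam / 2 * ‖w - θ‖ ^ 2 := rfl

namespace ConvexLipschitzLoss

lemma mul_pos (H : ConvexLipschitzLoss X Y l L R) : 0 < L * R :=
  _root_.mul_pos H.L_pos H.R_pos

lemma abs_lossAt_sub_le (H : ConvexLipschitzLoss X Y l L R) (z : Datum X Y) (w w' : Vec d) :
    |lossAt l w z - lossAt l w' z| ≤ L * R * ‖w - w'‖ := by
  refine (H.lipschitz _ z.2.2 _ _).trans ?_
  rw [← inner_sub_right, mul_assoc]
  refine mul_le_mul_of_nonneg_left ?_ H.L_pos.le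
  exact (abs_real_inner_le_norm _ _).trans
    (mul_le_mul_of_nonneg_right (H.bounded _ z.1.2) (norm_nonneg _))

lemma lossAt_sub_le (H : ConvexLipschitzLoss X Y l L R) (z : Datum X Y) (w w' : Vec d) :
    lossAt l w z - lossAt l w' z ≤ L * R * ‖w - w'‖ :=
  (le_abs_self _).trans (H.abs_lossAt_sub_le z w w')

lemma convexOn_lossAt (H : ConvexLipschitzLoss X Y l L R) (z : Datum X Y) :
    ConvexOn ℝ Set.univ fun w => lossAt l w z :=
  (H.convex _ z.2.2).comp_linearMap (innerₛₗ ℝ (z.1 : Vec d))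

lemma convexOn_empRisk (H : ConvexLipschitzLoss X Y l L R) (Z : Fin n → Datum X Y) :
    ConvexOn ℝ Set.univ (empRisk l Z) := by
  have h : ∀ s : Finset (Fin n), ConvexOn ℝ Set.univ fun w => ∑ i ∈ s, lossAt l w (Z i) := by
    intro s
    induction s using Finset.cons_induction with
    | empty => simpa using convexOn_const (0 : ℝ) convex_univ
    | cons i s hi ih =>
      simp only [Finset.sum_cons]
      exact (H.convexOn_lossAt (Z i)).add ih
  exact (h Finset.univ).smul (by positivity)

lemma empRisk_sub_le (H : ConvexLipschitzLoss X Y l L R) (Z : Fin n → Datum X Y) (w w' : Vec d) :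
    empRisk l Z w - empRisk l Z w' ≤ L * R * ‖w - w'‖ := by
  rw [empRisk, empRisk, ← mul_sub, ← Finset.sum_sub_distrib]
  have h : ∑ i, (lossAt l w (Z i) - lossAt l w' (Z i)) ≤ n * (L * R * ‖w - w'‖) := by
    simpa using Finset.sum_le_card_nsmul Finset.univ _ _ fun i _ => H.lossAt_sub_le (Z i) w w'
  have h0 : 0 ≤ L * R * ‖w - w'‖ := mul_nonneg H.mul_pos.le (norm_nonneg _)
  -- For `n = 0` the convention `1 / 0 = 0` makes the empirical risk vanish.
  rcases Nat.eq_zero_or_pos n with rfl | hn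
  · simpa using h0
  · have : (0 : ℝ) < n := by exact_mod_cast hn
    rw [one_div, inv_mul_le_iff₀ this]
    exact h

lemma abs_empRisk_sub_le (H : ConvexLipschitzLoss X Y l L R) (Z : Fin n → Datum X Y)
    (w w' : Vec d) : |empRisk l Z w - empRisk l Z w'| ≤ L * R * ‖w - w'‖ :=
  abs_le.2 ⟨by have := H.empRisk_sub_le Z w' w; rw [norm_sub_rev] at this; linarith,
    H.empRisk_sub_le Z w w'⟩

lemma continuous_empRisk (H : ConvexLipschitzLoss X Y l L R) (Z : Fin n → Datum X Y) :
    Continuous (empRisk l Z) := by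
  refine (LipschitzWith.of_dist_le_mul (K := ⟨L * R, H.mul_pos.le⟩) fun w w' => ?_).continuous
  rw [Real.dist_eq, dist_eq_norm]
  exact H.abs_empRisk_sub_le Z w w'

lemma continuous_regRisk (H : ConvexLipschitzLoss X Y l L R) (θ : Vec d) (Z : Fin n → Datum X Y) :
    Continuous (regRisk l lam θ Z) :=
  (H.continuous_empRisk Z).add (by fun_prop)

/-- The choice in `innerAlg` is meaningful only once a minimizer exists. With `r = ‖w - θ‖`, the
regularized risk is at least its value at `θ` plus `r (λ r / 2 - L R)`, so it is coercive as well as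
continuous. -/
lemma isMinOn_innerAlg (H : ConvexLipschitzLoss X Y l L R) (hlam : 0 < lam) (θ : Vec d)
    (Z : Fin n → Datum X Y) : IsMinOn (regRisk l lam θ Z) Set.univ (innerAlg l lam θ Z) := by
  refine Classical.epsilon_spec (p := fun w => IsMinOn (regRisk l lam θ Z) Set.univ w) ?_
  obtain ⟨w, hw⟩ := (H.continuous_regRisk (lam := lam) θ Z).exists_forall_le (by
    have hnorm : Tendsto (fun w : Vec d => ‖w - θ‖) (cocompact (Vec d)) atTop := by
      simpa [dist_eq_norm] using tendsto_dist_right_cocompact_atTop θ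
    have hpoly : Tendsto (fun r : ℝ => r * (lam / 2 * r - L * R)) atTop atTop := by
      refine tendsto_id.atTop_mul_atTop₀ ?_
      exact tendsto_atTop_add_const_right _ _ (tendsto_id.const_mul_atTop (by positivity))
    refine tendsto_atTop_mono (fun w => ?_)
      (tendsto_atTop_add_const_left _ (empRisk l Z θ) (hpoly.comp hnorm))
    have := H.empRisk_sub_le Z θ w
    rw [norm_sub_rev] at this
    rw [regRisk_eq, Function.comp_apply]
    nlinarith)
  exact ⟨w, fun v _ => hw v⟩

lemma regRisk_innerAlg_le (H : ConvexLipschitzLoss X Y l L R) (hlam : 0 < lam) (θ : Vec d)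
    (Z : Fin n → Datum X Y) (w : Vec d) : envelope l lam θ Z ≤ regRisk l lam θ Z w :=
  H.isMinOn_innerAlg hlam θ Z (Set.mem_univ w)

/-- The variational inequality that characterizes the output of the inner algorithm. -/
lemma innerAlg_variational (H : ConvexLipschitzLoss X Y l L R) (hlam : 0 < lam) (θ : Vec d)
    (Z : Fin n → Datum X Y) (v : Vec d) :
    empRisk l Z (innerAlg l lam θ Z)
      - lam * ⟪innerAlg l lam θ Z - θ, v - innerAlg l lam θ Z⟫ ≤ empRisk l Z v :=
  prox_variational (H.convexOn_empRisk Z) (H.isMinOn_innerAlg hlam θ Z) v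

/-- Quadratic growth of the regularized risk around its minimizer. -/
lemma envelope_add_le_regRisk (H : ConvexLipschitzLoss X Y l L R) (hlam : 0 < lam) (θ : Vec d)
    (Z : Fin n → Datum X Y) (v : Vec d) :
    envelope l lam θ Z + lam / 2 * ‖v - innerAlg l lam θ Z‖ ^ 2 ≤ regRisk l lam θ Z v := by
  have h := H.innerAlg_variational hlam θ Z v
  rw [envelope, regRisk_eq, regRisk_eq]
  set w := innerAlg l lam θ Z
  have e : v - θ = (w - θ) + (v - w) := by abel
  rw [e, norm_add_sq_real]
  linarith

/-- Optimality tested at `v = θ` gives `λ ‖w - θ‖²` at most the drop in empirical risk from `θ` to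
`w`, which is at most `L R ‖w - θ‖`. -/
lemma norm_innerAlg_sub_le (H : ConvexLipschitzLoss X Y l L R) (hlam : 0 < lam) (θ : Vec d)
    (Z : Fin n → Datum X Y) : lam * ‖innerAlg l lam θ Z - θ‖ ≤ L * R := by
  have h := H.innerAlg_variational hlam θ Z θ
  set w := innerAlg l lam θ Z
  have h2 := H.empRisk_sub_le Z θ w
  rw [← neg_sub w θ, inner_neg_right, real_inner_self_eq_norm_sq] at h
  rw [norm_sub_rev] at h2
  rcases (norm_nonneg (w - θ)).eq_or_lt with h0 | h0
  · rw [← h0, mul_zero]; exact H.mul_pos.le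
  · refine le_of_mul_le_mul_right ?_ h0
    nlinarith

lemma norm_innerAlg_sub_le_div (H : ConvexLipschitzLoss X Y l L R) (hlam : 0 < lam) (θ : Vec d)
    (Z : Fin n → Datum X Y) : ‖innerAlg l lam θ Z - θ‖ ≤ L * R / lam := by
  rw [le_div_iff₀ hlam, mul_comm]
  exact H.norm_innerAlg_sub_le hlam θ Z

/-- The output of the inner algorithm is stable under the replacement of one datum. -/
lemma norm_innerAlg_sub_innerAlg_le_of_eqOn (H : ConvexLipschitzLoss X Y l L R) (hlam : 0 < lam)
    (hn : 0 < n) (θ : Vec d) (Z Z' : Fin n → Datum X Y) (i : Fin n)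
    (hZ : ∀ j ≠ i, Z j = Z' j) :
    ‖innerAlg l lam θ Z - innerAlg l lam θ Z'‖ ≤ 2 * (L * R) / (lam * n) := by
  have h := H.innerAlg_variational hlam θ Z (innerAlg l lam θ Z')
  have h' := H.innerAlg_variational hlam θ Z' (innerAlg l lam θ Z)
  set w := innerAlg l lam θ Z
  set w' := innerAlg l lam θ Z'
  have hd : ∀ v, empRisk l Z v - empRisk l Z' v
      = 1 / (n : ℝ) * (lossAt l v (Z i) - lossAt l v (Z' i)) := by
    intro v
    rw [empRisk, empRisk, ← mul_sub, ← Finset.sum_sub_distrib,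
      Finset.sum_eq_single i (fun j _ hj => by rw [hZ j hj, sub_self])
        (fun hi => absurd (Finset.mem_univ i) hi)]
  have e : ⟪w - θ, w' - w⟫ + ⟪w' - θ, w - w'⟫ = - ‖w - w'‖ ^ 2 := by
    rw [← neg_sub w w', inner_neg_right, ← sub_eq_neg_add, ← inner_sub_left,
      ← real_inner_self_eq_norm_sq, ← inner_neg_left]
    congr 1
    abel
  have hn' : (0 : ℝ) < n := by exact_mod_cast hn
  have h1 := H.lossAt_sub_le (Z i) w' w
  have h2 := H.lossAt_sub_le (Z' i) w w'
  rw [norm_sub_rev] at h1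
  have hw := hd w
  have hw' := hd w'
  have hmul : lam * ‖w - w'‖ ^ 2 ≤ 1 / (n : ℝ) * (2 * (L * R * ‖w - w'‖)) := by
    -- Sum of the two optimality conditions, each tested at the other minimizer. The empirical risks
    -- regroup so that only the replaced datum contributes, with weight `1 / n`.
    have h3 : lam * ‖w - w'‖ ^ 2 ≤ (empRisk l Z w' - empRisk l Z' w')
        - (empRisk l Z w - empRisk l Z' w) := by
      have : lam * (⟪w - θ, w' - w⟫ + ⟪w' - θ, w - w'⟫) = lam * (- ‖w - w'‖ ^ 2) := by rw [e]
      linarith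
    refine h3.trans ?_
    rw [hw, hw', ← mul_sub]
    exact mul_le_mul_of_nonneg_left (by linarith) (by positivity)
  rcases (norm_nonneg (w - w')).eq_or_lt with h0 | h0
  · rw [← h0]; have := H.mul_pos; positivity
  · rw [le_div_iff₀ (by positivity)]
    refine le_of_mul_le_mul_right ?_ h0
    have h4 := mul_le_mul_of_nonneg_left hmul hn'.le
    rw [← mul_assoc, ← mul_assoc (n : ℝ), mul_one_div_cancel hn'.ne', one_mul] at h4
    linarith

/-- The Moreau envelope lies above its linearization at `θ`. -/
lemma envelope_sub_le (H : ConvexLipschitzLoss X Y l L R) (hlam : 0 < lam) (θ θ' : Vec d)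
    (Z : Fin n → Datum X Y) :
    envelope l lam θ Z - envelope l lam θ' Z
      ≤ ⟪-lam • (innerAlg l lam θ Z - θ), θ - θ'⟫ := by
  have h := H.innerAlg_variational hlam θ Z (innerAlg l lam θ' Z)
  rw [envelope, envelope, regRisk_eq, regRisk_eq]
  set w := innerAlg l lam θ Z
  set w' := innerAlg l lam θ' Z
  have e : w' - w = (w' - θ') - (w - θ) - (θ - θ') := by abel
  have hsq := norm_sub_sq_real (w - θ) (w' - θ')
  -- This square is exactly the slack left after expanding the optimality condition at `w'`.
  have hpos : 0 ≤ lam / 2 * ‖w - θ - (w' - θ')‖ ^ 2 := by positivity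
  rw [e, inner_sub_right, inner_sub_right, real_inner_self_eq_norm_sq] at h
  rw [inner_smul_left, RCLike.conj_to_real]
  nlinarith

lemma norm_metaGrad_le (H : ConvexLipschitzLoss X Y l L R) (hlam : 0 < lam) (θ : Vec d)
    (Z : Fin n → Datum X Y) : ‖-lam • (innerAlg l lam θ Z - θ)‖ ≤ L * R := by
  rw [norm_smul, norm_neg, Real.norm_eq_abs, abs_of_pos hlam]
  exact H.norm_innerAlg_sub_le hlam θ Z

/-- Subgradients have norm at most `L R`, whatever the dataset. Differences of envelopes are
therefore integrable with no moment assumption on the data, which is why later estimates use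
differences and never an envelope alone. -/
lemma abs_envelope_sub_le (H : ConvexLipschitzLoss X Y l L R) (hlam : 0 < lam) (θ θ' : Vec d)
    (Z : Fin n → Datum X Y) :
    |envelope l lam θ Z - envelope l lam θ' Z| ≤ L * R * ‖θ - θ'‖ := by
  have key : ∀ θ θ', envelope l lam θ Z - envelope l lam θ' Z ≤ L * R * ‖θ - θ'‖ := fun θ θ' =>
    ((H.envelope_sub_le hlam θ θ' Z).trans (real_inner_le_norm _ _)).trans
      (mul_le_mul_of_nonneg_right (H.norm_metaGrad_le hlam θ Z) (norm_nonneg _))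
  refine abs_le.2 ⟨?_, key θ θ'⟩
  have := key θ' θ
  rw [norm_sub_rev] at this
  linarith

end ConvexLipschitzLoss

end Deterministic

/-! ### Measurability of the inner and meta algorithms -/

section Measurability

variable {d n : ℕ} {X : Set (Vec d)} {Y : Set ℝ} {l : ℝ → ℝ → ℝ} {L R lam : ℝ}
  {α : Type*} [MeasurableSpace α]

namespace ConvexLipschitzLoss

lemma measurable_lossAt (H : ConvexLipschitzLoss X Y l L R) {w : α → Vec d} {z : α → Datum X Y}
    (hw : Measurable w) (hz : Measurable z) : Measurable fun a => lossAt l (w a) (z a) := by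
  have h1 : Measurable fun a => ((z a).1 : Vec d) := measurable_subtype_coe.comp hz.fst
  have h2 : Measurable fun a => ((z a).2 : ℝ) := measurable_subtype_coe.comp hz.snd
  exact H.meas.comp ((h1.inner hw).prodMk h2)

lemma measurable_empRisk (H : ConvexLipschitzLoss X Y l L R) {w : α → Vec d}
    {Z : α → Fin n → Datum X Y} (hw : Measurable w) (hZ : Measurable Z) :
    Measurable fun a => empRisk l (Z a) (w a) :=
  (Finset.measurable_sum _ fun i _ =>
    H.measurable_lossAt hw ((measurable_pi_apply i).comp hZ)).const_mul _

lemma measurable_regRisk (H : ConvexLipschitzLoss X Y l L R) {θ w : α → Vec d}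
    {Z : α → Fin n → Datum X Y} (hθ : Measurable θ) (hw : Measurable w) (hZ : Measurable Z) :
    Measurable fun a => regRisk l lam (θ a) (Z a) (w a) :=
  (H.measurable_empRisk hw hZ).add (((hw.sub hθ).norm.pow_const 2).const_mul _)

/-- The output of the inner algorithm depends measurably on the bias and on the dataset. -/
lemma measurable_innerAlg (H : ConvexLipschitzLoss X Y l L R) (hlam : 0 < lam) {θ : α → Vec d}
    {Z : α → Fin n → Datum X Y} (hθ : Measurable θ) (hZ : Measurable Z) :
    Measurable fun a => innerAlg l lam (θ a) (Z a) := by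
  classical
  let u : ℕ → Vec d := TopologicalSpace.denseSeq (Vec d)
  have hu : DenseRange u := TopologicalSpace.denseRange_denseSeq _
  -- Near-minimality of `u j` is tested against the dense sequence only, so it is a countable
  -- intersection of measurable conditions.
  let good : ℕ → ℕ → α → Prop := fun m j a =>
    ∀ i, regRisk l lam (θ a) (Z a) (u j) ≤ regRisk l lam (θ a) (Z a) (u i) + 1 / ((m : ℝ) + 1)
  have hgood_meas : ∀ m j, MeasurableSet {a | good m j a} := by
    intro m j
    simp only [good, Set.ofPred_forall]
    exact MeasurableSet.iInter fun i =>
      measurableSet_le (H.measurable_regRisk hθ measurable_const hZ)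
        ((H.measurable_regRisk hθ measurable_const hZ).add_const _)
  have hex : ∀ m a, ∃ j, good m j a := by
    intro m a
    have hopen : IsOpen {v | regRisk l lam (θ a) (Z a) v
        < envelope l lam (θ a) (Z a) + 1 / ((m : ℝ) + 1)} :=
      isOpen_lt (H.continuous_regRisk _ _) continuous_const
    obtain ⟨j, hj⟩ := hu.exists_mem_open hopen
      ⟨innerAlg l lam (θ a) (Z a), show envelope l lam (θ a) (Z a) < _ from
        lt_add_of_pos_right _ Nat.one_div_pos_of_nat⟩
    refine ⟨j, fun i => (le_of_lt hj).trans ?_⟩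
    exact add_le_add_left (H.regRisk_innerAlg_le hlam _ _ _) _
  -- By density and continuity, near-minimality also holds against the true minimizer. Quadratic
  -- growth then turns a small gap in value into a small distance.
  have hclose : ∀ m j a, good m j a →
      lam / 2 * ‖u j - innerAlg l lam (θ a) (Z a)‖ ^ 2 ≤ 1 / ((m : ℝ) + 1) := by
    intro m j a hj
    have hclosed : IsClosed {v | regRisk l lam (θ a) (Z a) (u j)
        ≤ regRisk l lam (θ a) (Z a) v + 1 / ((m : ℝ) + 1)} :=
      isClosed_le continuous_const ((H.continuous_regRisk _ _).add continuous_const)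
    have hall := hu.induction_on (p := fun v => regRisk l lam (θ a) (Z a) (u j)
        ≤ regRisk l lam (θ a) (Z a) v + 1 / ((m : ℝ) + 1)) (innerAlg l lam (θ a) (Z a)) hclosed hj
    have := H.envelope_add_le_regRisk hlam (θ a) (Z a) (u j)
    rw [envelope] at this
    linarith
  -- The first good index at tolerance `1 / (m + 1)` is a measurable selection, and the selected
  -- points converge to the minimizer.
  refine measurable_of_tendsto_metrizable
    (f := fun m a => u (Nat.find (hex m a))) (fun m => ?_) ?_
  · exact Measurable.find (f := fun j _ => u j) (fun _ => measurable_const) (hgood_meas m) (hex m)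
  · rw [tendsto_pi_nhds]
    intro a
    rw [tendsto_iff_norm_sub_tendsto_zero]
    have hsq : Tendsto (fun m : ℕ =>
        ‖u (Nat.find (hex m a)) - innerAlg l lam (θ a) (Z a)‖ ^ 2) atTop (𝓝 0) := by
      have hlim : Tendsto (fun m : ℕ => 2 / lam * (1 / ((m : ℝ) + 1))) atTop (𝓝 0) := by
        simpa using tendsto_one_div_add_atTop_nhds_zero_nat.const_mul (2 / lam)
      refine squeeze_zero (fun _ => by positivity) (fun m => ?_) hlim
      have := hclose m _ a (Nat.find_spec (hex m a))
      calc _ = 2 / lam * (lam / 2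
            * ‖u (Nat.find (hex m a)) - innerAlg l lam (θ a) (Z a)‖ ^ 2) := by
            field_simp
        _ ≤ _ := mul_le_mul_of_nonneg_left this (by positivity)
    simpa [Real.sqrt_sq] using hsq.sqrt

lemma measurable_envelope (H : ConvexLipschitzLoss X Y l L R) (hlam : 0 < lam) {θ : α → Vec d}
    {Z : α → Fin n → Datum X Y} (hθ : Measurable θ) (hZ : Measurable Z) :
    Measurable fun a => envelope l lam (θ a) (Z a) :=
  H.measurable_regRisk hθ (H.measurable_innerAlg hlam hθ hZ) hZ

lemma measurable_risk (H : ConvexLipschitzLoss X Y l L R) {μ : α → LearningTask X Y}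
    {w : α → Vec d} (hμ : Measurable μ) (hw : Measurable w) :
    Measurable fun a => risk l (μ a) (w a) := by
  let κ : Kernel α (Datum X Y) := ⟨fun a => (μ a : Measure (Datum X Y)),
    measurable_subtype_coe.comp hμ⟩
  have : IsMarkovKernel κ := ⟨fun a => inferInstanceAs (IsProbabilityMeasure
    (μ a : Measure (Datum X Y)))⟩
  exact (StronglyMeasurable.integral_kernel_prod_right' (κ := κ)
    (f := fun q : α × Datum X Y => lossAt l (w q.1) q.2)
    (H.measurable_lossAt (hw.comp measurable_fst) measurable_snd).stronglyMeasurable).measurable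

end ConvexLipschitzLoss

instance paramMatrixMeasurableSpace (d k : ℕ) : MeasurableSpace (Matrix (Fin d) (Fin k) ℝ) :=
  inferInstanceAs (MeasurableSpace (Fin d → Fin k → ℝ))

lemma measurable_matrix_iff {d k : ℕ} {M : α → Matrix (Fin d) (Fin k) ℝ} :
    Measurable M ↔ ∀ i j, Measurable fun a => M a i j := by
  refine measurable_pi_iff.trans (forall_congr' fun i => ?_)
  exact measurable_pi_iff

lemma measurable_linCond {k : ℕ} {S : Type*} [MeasurableSpace S]
    {Φ : S → EuclideanSpace ℝ (Fin k)} (hΦ : Measurable Φ) {P : α → Params d k} {s : α → S}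
    (hP : Measurable P) (hs : Measurable s) : Measurable fun a => linCond Φ (P a) (s a) := by
  refine Measurable.add ?_ hP.snd
  have hM := measurable_matrix_iff.1 hP.fst
  have h : Measurable fun a => fun i => ∑ j, (P a).1 i j * Φ (s a) j := by
    refine measurable_pi_iff.2 fun i => Finset.measurable_sum _ fun j _ => (hM i j).mul ?_
    exact (measurable_pi_apply j).comp ((WithLp.measurable_ofLp 2 _).comp (hΦ.comp hs))
  exact (WithLp.measurable_toLp 2 _).comp h

lemma measurable_metaGrad (H : ConvexLipschitzLoss X Y l L R) (hlam : 0 < lam) {k : ℕ}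
    {S : Type*} [MeasurableSpace S]
    {Φ : S → EuclideanSpace ℝ (Fin k)} (hΦ : Measurable Φ) {P : α → Params d k}
    {e : α → (Fin n → Datum X Y) × S} (hP : Measurable P) (he : Measurable e) :
    Measurable fun a => metaGrad l lam Φ (P a) (e a) := by
  have hθ := measurable_linCond hΦ hP he.snd
  have hg : Measurable fun a => -lam • (innerAlg l lam (linCond Φ (P a) (e a).2) (e a).1
      - linCond Φ (P a) (e a).2) :=
    ((H.measurable_innerAlg hlam hθ he.fst).sub hθ).const_smul (-lam)
  refine Measurable.prodMk (measurable_matrix_iff.2 fun i j => ?_) hg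
  exact ((measurable_pi_apply i).comp ((WithLp.measurable_ofLp 2 _).comp hg)).mul
    ((measurable_pi_apply j).comp ((WithLp.measurable_ofLp 2 _).comp (hΦ.comp he.snd)))

lemma measurable_params_add {k : ℕ} {P Q : α → Params d k} (hP : Measurable P)
    (hQ : Measurable Q) : Measurable fun a => P a + Q a := by
  refine Measurable.prodMk (measurable_matrix_iff.2 fun i j => ?_) (hP.snd.add hQ.snd)
  exact (measurable_matrix_iff.1 hP.fst i j).add (measurable_matrix_iff.1 hQ.fst i j)

lemma measurable_params_smul {k : ℕ} {P : α → Params d k} (c : ℝ) (hP : Measurable P) :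
    Measurable fun a => c • P a := by
  refine Measurable.prodMk (measurable_matrix_iff.2 fun i j => ?_) (hP.snd.const_smul c)
  exact (measurable_matrix_iff.1 hP.fst i j).const_mul c

lemma measurable_sgdIterate (H : ConvexLipschitzLoss X Y l L R) (hlam : 0 < lam) {k : ℕ}
    {S : Type*} [MeasurableSpace S] {Φ : S → EuclideanSpace ℝ (Fin k)} (hΦ : Measurable Φ)
    (γ : ℝ) {e : ℕ → α → (Fin n → Datum X Y) × S} (t : ℕ) (he : ∀ i < t, Measurable (e i)) :
    Measurable fun a => sgdIterate l lam γ Φ (fun i => e i a) t := by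
  induction t with
  | zero => exact measurable_const
  | succ t ih =>
    have h := ih fun i hi => he i (hi.trans t.lt_succ_self)
    have := measurable_params_add h (measurable_params_smul (-γ)
      (measurable_metaGrad H hlam hΦ h (he t t.lt_succ_self)))
    simpa only [sgdIterate, sub_eq_add_neg, neg_smul] using this

lemma measurable_sgdOutput (H : ConvexLipschitzLoss X Y l L R) (hlam : 0 < lam) {k : ℕ}
    {S : Type*} [MeasurableSpace S] {Φ : S → EuclideanSpace ℝ (Fin k)} (hΦ : Measurable Φ)
    (γ : ℝ) {T : ℕ} {e : ℕ → α → (Fin n → Datum X Y) × S} (he : ∀ i < T, Measurable (e i)) :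
    Measurable fun a => sgdOutput l lam γ Φ T fun i => e i a := by
  refine measurable_params_smul _ ?_
  have hsum : ∀ m ≤ T, Measurable fun a =>
      ∑ t ∈ Finset.range m, sgdIterate l lam γ Φ (fun i => e i a) t := by
    intro m
    induction m with
    | zero => exact fun _ => by simp
    | succ m ih =>
      intro hm
      simp only [Finset.sum_range_succ]
      exact measurable_params_add (ih (by omega))
        (measurable_sgdIterate H hlam hΦ γ m fun i hi => he i (by omega))
  exact hsum T le_rfl

end Measurability

/-! ### Generalization within a task, by stability -/

section Generalization

variable {d n : ℕ} {X : Set (Vec d)} {Y : Set ℝ} {l : ℝ → ℝ → ℝ} {L R lam : ℝ}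

lemma measurePreserving_comp_perm {α ι : Type*} [MeasurableSpace α] [Fintype ι] (μ : Measure α)
    [SigmaFinite μ] (σ : Equiv.Perm ι) :
    MeasurePreserving (fun W : ι → α => fun i => W (σ i)) (Measure.pi fun _ => μ)
      (Measure.pi fun _ => μ) := by
  have h := measurePreserving_piCongrLeft (α := fun _ : ι => α) (fun _ : ι => μ) σ.symm
  convert h using 1
  ext W i
  have := Equiv.piCongrLeft_apply (P := fun _ : ι => α) σ.symm W i
  rw [MeasurableEquiv.coe_piCongrLeft]
  simpa using this.symm

namespace ConvexLipschitzLoss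

/-- Moving from `θ` to a data-dependent vector at bounded distance changes the loss by a bounded
amount, so integrability at the single vector `θ` suffices. -/
lemma integrable_lossAt_comp (H : ConvexLipschitzLoss X Y l L R) {μ : Measure (Datum X Y)}
    {α : Type*} [MeasurableSpace α] {ν : Measure α} [IsProbabilityMeasure ν] {θ : Vec d}
    (hint : Integrable (lossAt l θ) μ) {z : α → Datum X Y} (hz : MeasurePreserving z ν μ)
    {w : α → Vec d} (hw : Measurable w) {C : ℝ} (hC : ∀ a, ‖w a - θ‖ ≤ C) :
    Integrable (fun a => lossAt l (w a) (z a)) ν := by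
  have h1 : Integrable (fun a => lossAt l θ (z a)) ν := hz.integrable_comp_of_integrable hint
  have h2 : Integrable (fun a => lossAt l (w a) (z a) - lossAt l θ (z a)) ν := by
    refine Integrable.of_bound ((H.measurable_lossAt hw hz.measurable).sub
      (H.measurable_lossAt measurable_const hz.measurable)).aestronglyMeasurable (L * R * C)
      (Eventually.of_forall fun a => ?_)
    exact (H.abs_lossAt_sub_le _ _ _).trans (mul_le_mul_of_nonneg_left (hC a) H.mul_pos.le)
  exact (h2.add h1).congr (Eventually.of_forall fun a => sub_add_cancel _ _)

variable {μ : LearningTask X Y}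

lemma integrable_empRisk_innerAlg (H : ConvexLipschitzLoss X Y l L R) (hlam : 0 < lam)
    {θ : Vec d} (hint : Integrable (lossAt l θ) (μ : Measure (Datum X Y))) :
    Integrable (fun Z : Fin n → Datum X Y => empRisk l Z (innerAlg l lam θ Z))
      (Measure.pi fun _ => (μ : Measure (Datum X Y))) :=
  (integrable_finsetSum _ fun i _ => H.integrable_lossAt_comp hint (measurePreserving_eval _ i)
    (H.measurable_innerAlg hlam measurable_const measurable_id)
    fun Z => H.norm_innerAlg_sub_le_div hlam θ Z).const_mul _

lemma integrable_empRisk {w : Vec d} (hint : Integrable (lossAt l w) (μ : Measure (Datum X Y))) :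
    Integrable (fun Z : Fin n → Datum X Y => empRisk l Z w)
      (Measure.pi fun _ => (μ : Measure (Datum X Y))) :=
  (integrable_finsetSum _ fun i _ =>
    (measurePreserving_eval _ i).integrable_comp_of_integrable hint).const_mul _

lemma integral_empRisk (hn : 0 < n) {w : Vec d}
    (hint : Integrable (lossAt l w) (μ : Measure (Datum X Y))) :
    ∫ Z : Fin n → Datum X Y, empRisk l Z w ∂(Measure.pi fun _ => (μ : Measure (Datum X Y)))
      = risk l μ w := by
  have hn' : (n : ℝ) ≠ 0 := by exact_mod_cast hn.ne'
  have h : ∀ i : Fin n, ∫ Z : Fin n → Datum X Y, lossAt l w (Z i)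
      ∂(Measure.pi fun _ => (μ : Measure (Datum X Y))) = risk l μ w := by
    intro i
    have hmp := measurePreserving_eval (fun _ : Fin n => (μ : Measure (Datum X Y))) i
    have := integral_map hmp.measurable.aemeasurable (f := lossAt l w)
      (by rw [hmp.map_eq]; exact hint.aestronglyMeasurable)
    rw [hmp.map_eq] at this
    exact this.symm
  simp only [empRisk]
  have hI : ∀ i : Fin n, Integrable (fun Z : Fin n → Datum X Y => lossAt l w (Z i))
      (Measure.pi fun _ => (μ : Measure (Datum X Y))) := fun i =>
    (measurePreserving_eval (fun _ : Fin n => (μ : Measure (Datum X Y))) i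
      ).integrable_comp_of_integrable (g := lossAt l w) hint
  rw [integral_const_mul, integral_finsetSum _ fun i _ => hI i]
  simp only [h, Finset.sum_const, Finset.card_univ, Fintype.card_fin, nsmul_eq_mul]
  field_simp

/-- The generalization gap of the inner algorithm, by stability. -/
lemma integral_risk_sub_integral_empRisk_le (H : ConvexLipschitzLoss X Y l L R) (hlam : 0 < lam)
    (hn : 0 < n) (θ : Vec d) (hint : Integrable (lossAt l θ) (μ : Measure (Datum X Y))) :
    ∫ Z : Fin n → Datum X Y, risk l μ (innerAlg l lam θ Z)
        ∂(Measure.pi fun _ => (μ : Measure (Datum X Y)))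
      - ∫ Z : Fin n → Datum X Y, empRisk l Z (innerAlg l lam θ Z)
        ∂(Measure.pi fun _ => (μ : Measure (Datum X Y)))
      ≤ 2 * (L * R) ^ 2 / (lam * n) := by
  set m : Measure (Datum X Y) := (μ : Measure (Datum X Y)) with hm
  -- A sample of `n + 1` points: coordinate `0` is a fresh test point and the tail is the training
  -- set. Risk and empirical risk become integrals over one space.
  let ν : Measure (Fin (n + 1) → Datum X Y) := Measure.pi fun _ => m
  let tail : (Fin (n + 1) → Datum X Y) → Fin n → Datum X Y := fun W i => W i.succ
  let A : (Fin n → Datum X Y) → Vec d := innerAlg l lam θ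
  have hA : Measurable A := H.measurable_innerAlg hlam measurable_const measurable_id
  have hAle : ∀ Z, ‖A Z - θ‖ ≤ L * R / lam := H.norm_innerAlg_sub_le_div hlam θ
  have hsplit : MeasurePreserving (fun W : Fin (n + 1) → Datum X Y => (W 0, tail W)) ν
      (m.prod (Measure.pi fun _ => m)) :=
    measurePreserving_piFinSuccAbove (α := fun _ => Datum X Y) (fun _ => m) 0
  have htail : MeasurePreserving tail ν (Measure.pi fun _ => m) :=
    measurePreserving_snd.comp hsplit
  have heval : ∀ i, MeasurePreserving (fun W : Fin (n + 1) → Datum X Y => W i) ν m := fun i =>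
    measurePreserving_eval (fun _ => m) i
  have hI : ∀ i, Integrable (fun W => lossAt l (A (tail W)) (W i)) ν := fun i =>
    H.integrable_lossAt_comp hint (heval i) (hA.comp htail.measurable) fun W => hAle _
  have hrisk : ∫ Z : Fin n → Datum X Y, risk l μ (A Z) ∂(Measure.pi fun _ => m)
      = ∫ W, lossAt l (A (tail W)) (W 0) ∂ν := by
    have hp : Integrable (fun q : Datum X Y × (Fin n → Datum X Y) => lossAt l (A q.2) q.1)
        (m.prod (Measure.pi fun _ => m)) :=
      H.integrable_lossAt_comp hint measurePreserving_fst (hA.comp measurable_snd) fun q => hAle _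
    rw [← integral_map hsplit.measurable.aemeasurable
      (f := fun q : Datum X Y × (Fin n → Datum X Y) => lossAt l (A q.2) q.1)
      (by rw [hsplit.map_eq]; exact hp.aestronglyMeasurable), hsplit.map_eq,
      integral_prod_symm _ hp]
    rfl
  have hemp : ∫ Z : Fin n → Datum X Y, empRisk l Z (A Z) ∂(Measure.pi fun _ => m)
      = 1 / (n : ℝ) * ∑ i : Fin n, ∫ W, lossAt l (A (tail W)) (W i.succ) ∂ν := by
    have hmeas := H.measurable_empRisk hA (Z := fun Z : Fin n → Datum X Y => Z) measurable_id
    rw [← htail.map_eq, integral_map htail.measurable.aemeasurable hmeas.aestronglyMeasurable,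
      ← integral_finsetSum _ fun i _ => hI i.succ, ← integral_const_mul]
    rfl
  have hswap : ∀ i : Fin n, ∫ W, lossAt l (A (tail W)) (W 0) ∂ν
      - ∫ W, lossAt l (A (tail W)) (W i.succ) ∂ν ≤ L * R * (2 * (L * R) / (lam * n)) := by
    intro i
    -- Exchanging the test point with the `i`-th training point preserves the law. Both losses are
    -- then evaluated at the same datum, with training sets differing in one entry, and stability
    -- applies.
    let σ : Equiv.Perm (Fin (n + 1)) := Equiv.swap 0 i.succ
    have hσ : MeasurePreserving (fun W : Fin (n + 1) → Datum X Y => fun j => W (σ j)) ν ν :=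
      measurePreserving_comp_perm m σ
    have hσ0 : σ 0 = i.succ := Equiv.swap_apply_left _ _
    have hIσ : Integrable (fun W => lossAt l (A (tail fun j => W (σ j))) (W i.succ)) ν := by
      have := hσ.integrable_comp_of_integrable (hI 0)
      simpa only [Function.comp_def, hσ0] using this
    have hE : ∫ W, lossAt l (A (tail W)) (W 0) ∂ν
        = ∫ W, lossAt l (A (tail fun j => W (σ j))) (W i.succ) ∂ν := by
      have := integral_map hσ.measurable.aemeasurable
        (f := fun W => lossAt l (A (tail W)) (W 0))
        (by rw [hσ.map_eq]; exact (hI 0).aestronglyMeasurable)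
      rw [hσ.map_eq] at this
      simpa only [hσ0] using this
    rw [hE, ← integral_sub hIσ (hI i.succ)]
    have hbound : ∀ W, lossAt l (A (tail fun j => W (σ j))) (W i.succ)
        - lossAt l (A (tail W)) (W i.succ) ≤ L * R * (2 * (L * R) / (lam * n)) := by
      intro W
      refine (H.lossAt_sub_le _ _ _).trans (mul_le_mul_of_nonneg_left ?_ H.mul_pos.le)
      refine H.norm_innerAlg_sub_innerAlg_le_of_eqOn hlam hn θ _ _ i fun j hj => ?_
      have : σ j.succ = j.succ := Equiv.swap_apply_of_ne_of_ne (Fin.succ_ne_zero j)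
        (fun h => hj (Fin.succ_injective _ h))
      simp only [tail, this]
    refine (integral_mono (hIσ.sub (hI i.succ)) (integrable_const _) hbound).trans ?_
    simp
  have hn' : (0 : ℝ) < n := by exact_mod_cast hn
  change ∫ Z : Fin n → Datum X Y, risk l μ (A Z) ∂(Measure.pi fun _ => m)
    - ∫ Z : Fin n → Datum X Y, empRisk l Z (A Z) ∂(Measure.pi fun _ => m) ≤ _
  rw [hrisk, hemp]
  have hsum := Finset.sum_le_card_nsmul Finset.univ _ _ fun i _ => hswap i
  simp only [Finset.sum_sub_distrib, Finset.sum_const, Finset.card_univ, Fintype.card_fin,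
    nsmul_eq_mul] at hsum
  set I := ∫ W, lossAt l (A (tail W)) (W 0) ∂ν
  set J := ∑ i : Fin n, ∫ W, lossAt l (A (tail W)) (W i.succ) ∂ν
  have e : I - 1 / (n : ℝ) * J = (n * I - J) / n := by field_simp
  rw [e, div_le_iff₀ hn']
  refine hsum.trans (le_of_eq ?_)
  field_simp

/-- The excess risk of the inner algorithm on a fixed task, relative to a comparison bias `θ'`
and a comparison vector `w`. -/
lemma integral_risk_le (H : ConvexLipschitzLoss X Y l L R) (hlam : 0 < lam) (hn : 0 < n)
    (θ θ' w : Vec d) (hint : ∀ w, Integrable (lossAt l w) (μ : Measure (Datum X Y))) :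
    ∫ Z : Fin n → Datum X Y, risk l μ (innerAlg l lam θ Z)
        ∂(Measure.pi fun _ => (μ : Measure (Datum X Y)))
      ≤ ∫ Z : Fin n → Datum X Y, (envelope l lam θ Z - envelope l lam θ' Z)
          ∂(Measure.pi fun _ => (μ : Measure (Datum X Y)))
        + (risk l μ w + lam / 2 * ‖w - θ'‖ ^ 2) + 2 * (L * R) ^ 2 / (lam * n) := by
  have hgap := H.integral_risk_sub_integral_empRisk_le (n := n) hlam hn θ (hint θ)
  have hD : Integrable (fun Z : Fin n → Datum X Y => envelope l lam θ Z - envelope l lam θ' Z)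
      (Measure.pi fun _ => (μ : Measure (Datum X Y))) :=
    Integrable.of_bound ((H.measurable_envelope hlam measurable_const measurable_id).sub
      (H.measurable_envelope hlam measurable_const measurable_id)).aestronglyMeasurable _
      (Eventually.of_forall fun Z => H.abs_envelope_sub_le hlam θ θ' Z)
  have hw : Integrable (fun Z : Fin n → Datum X Y => empRisk l Z w + lam / 2 * ‖w - θ'‖ ^ 2)
      (Measure.pi fun _ => (μ : Measure (Datum X Y))) :=
    (integrable_empRisk (hint w)).add (integrable_const _)
  -- Pointwise, the empirical risk at the output is at most the envelope at `θ`. Adding and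
  -- subtracting the envelope at `θ'`, which is at most the regularized risk of `w`, gives the
  -- bound.
  have hle := integral_mono (H.integrable_empRisk_innerAlg (n := n) hlam (hint θ)) (hD.add hw)
    fun Z => show _ ≤ envelope l lam θ Z - envelope l lam θ' Z
        + (empRisk l Z w + lam / 2 * ‖w - θ'‖ ^ 2) by
      have h1 := H.regRisk_innerAlg_le hlam θ' Z w
      have h2 : 0 ≤ lam / 2 * ‖innerAlg l lam θ Z - θ‖ ^ 2 := by positivity
      have h3 : envelope l lam θ Z = _ := regRisk_eq θ Z (innerAlg l lam θ Z)
      rw [regRisk_eq] at h1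
      linarith
  have hsplit : ∫ Z : Fin n → Datum X Y, (empRisk l Z w + lam / 2 * ‖w - θ'‖ ^ 2)
      ∂(Measure.pi fun _ => (μ : Measure (Datum X Y)))
      = risk l μ w + lam / 2 * ‖w - θ'‖ ^ 2 := by
    rw [integral_add (integrable_empRisk (hint w)) (integrable_const _),
      integral_empRisk hn (hint w)]
    simp
  rw [integral_add' hD hw, hsplit] at hle
  linarith

end ConvexLipschitzLoss

end Generalization

/-! ### Regret of the meta-algorithm -/

section Regret

variable {d k n : ℕ} {X : Set (Vec d)} {Y : Set ℝ} {l : ℝ → ℝ → ℝ} {L R K lam : ℝ}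
  {S : Type*} {Φ : S → EuclideanSpace ℝ (Fin k)}

/-- The conditioning function depends linearly on the meta-parameters. -/
noncomputable def linCondₗ (Φ : S → EuclideanSpace ℝ (Fin k)) (s : S) : Params d k →ₗ[ℝ] Vec d where
  toFun P := linCond Φ P s
  map_add' P Q := by
    simp only [linCond, Prod.fst_add, Prod.snd_add, map_add, LinearMap.add_apply]
    abel
  map_smul' c P := by
    simp only [linCond, Prod.smul_fst, Prod.smul_snd, map_smul, LinearMap.smul_apply, smul_add,
      RingHom.id_apply]

@[simp]
lemma linCondₗ_apply (s : S) (P : Params d k) : linCondₗ Φ s P = linCond Φ P s := rfl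

/-- The rank-one meta-parameters `(g Φ(s)ᵀ, g)`. -/
noncomputable def rankOne (φ : EuclideanSpace ℝ (Fin k)) (g : Vec d) : Params d k :=
  (Matrix.of fun i j => g i * φ j, g)

lemma metaGrad_eq (P : Params d k) (e : (Fin n → Datum X Y) × S) :
    metaGrad l lam Φ P e = rankOne (Φ e.2)
      (-lam • (innerAlg l lam (linCond Φ P e.2) e.1 - linCond Φ P e.2)) := rfl

lemma linCond_rankOne (φ : EuclideanSpace ℝ (Fin k)) (g : Vec d) (s : S) :
    linCond Φ (rankOne φ g) s = (⟪φ, Φ s⟫ + 1) • g := by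
  ext i
  simp only [linCond, rankOne, Matrix.toLpLin_apply, PiLp.add_apply, Matrix.mulVec,
    dotProduct, Matrix.of_apply, PiLp.smul_apply, smul_eq_mul, PiLp.inner_apply,
    RCLike.inner_apply, conj_trivial, add_mul, one_mul, Finset.sum_mul]
  congr 1
  exact Finset.sum_congr rfl fun j _ => by ring

/-- The squared Frobenius norm of meta-parameters. -/
noncomputable def frobSq (P : Params d k) : ℝ := ∑ i, ∑ j, P.1 i j ^ 2 + ‖P.2‖ ^ 2

lemma frobSq_nonneg (P : Params d k) : 0 ≤ frobSq P := by
  unfold frobSq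
  positivity

lemma frobNorm_sq (P : Params d k) : frobNorm P ^ 2 = frobSq P :=
  Real.sq_sqrt (frobSq_nonneg P)

lemma frobSq_neg (P : Params d k) : frobSq (-P) = frobSq P := by
  simp [frobSq]

lemma frobSq_rankOne (φ : EuclideanSpace ℝ (Fin k)) (g : Vec d) :
    frobSq (rankOne φ g) = ‖g‖ ^ 2 * (‖φ‖ ^ 2 + 1) := by
  simp only [frobSq, rankOne, Matrix.of_apply, mul_pow, EuclideanSpace.norm_sq_eq,
    Real.norm_eq_abs, sq_abs, mul_add, mul_one, Finset.sum_mul_sum]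

/-- The map `g ↦ rankOne (Φ s) g` is adjoint to `P ↦ linCond Φ P s` for the Frobenius inner product.
The cross term thus becomes an inner product of biases, the quantity bounded by the subgradient
inequality. -/
lemma frobSq_sub_smul_rankOne (P : Params d k) (γ : ℝ) (g : Vec d) (s : S) :
    frobSq (P - γ • rankOne (Φ s) g) = frobSq P - 2 * γ * ⟪g, linCond Φ P s⟫
      + γ ^ 2 * frobSq (rankOne (Φ s) g) := by
  have h1 : ‖P.2 - γ • g‖ ^ 2 = ‖P.2‖ ^ 2 - 2 * γ * ⟪g, P.2⟫ + γ ^ 2 * ‖g‖ ^ 2 := by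
    rw [norm_sub_sq_real, norm_smul, mul_pow, Real.norm_eq_abs, sq_abs, inner_smul_right,
      real_inner_comm]
    ring
  have h2 : ⟪g, Matrix.toEuclideanLin P.1 (Φ s)⟫ = ∑ i, ∑ j, P.1 i j * (g i * Φ s j) := by
    simp only [PiLp.inner_apply, Matrix.toLpLin_apply, Matrix.mulVec, dotProduct,
      RCLike.inner_apply, conj_trivial, Finset.sum_mul]
    exact Finset.sum_congr rfl fun i _ => Finset.sum_congr rfl fun j _ => by ring
  have h3 : ∑ i, ∑ j, (P.1 i j - γ * (g i * Φ s j)) ^ 2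
      = ∑ i, ∑ j, P.1 i j ^ 2 - 2 * γ * ∑ i, ∑ j, P.1 i j * (g i * Φ s j)
        + γ ^ 2 * ∑ i, ∑ j, (g i * Φ s j) ^ 2 := by
    simp only [Finset.mul_sum, ← Finset.sum_sub_distrib, ← Finset.sum_add_distrib]
    exact Finset.sum_congr rfl fun i _ => Finset.sum_congr rfl fun j _ => by ring
  have h4 : frobSq (P - γ • rankOne (Φ s) g)
      = ∑ i, ∑ j, (P.1 i j - γ * (g i * Φ s j)) ^ 2 + ‖P.2 - γ • g‖ ^ 2 := rfl
  rw [h4, h3, h1, linCond, inner_add_right, h2]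
  simp only [frobSq, rankOne, Matrix.of_apply]
  ring

/-- The excess of the Moreau envelope at `(M, b) = P` over that at `(M, b) = Q`. -/
noncomputable def envelopeDiff (l : ℝ → ℝ → ℝ) (lam : ℝ) (Φ : S → EuclideanSpace ℝ (Fin k))
    (Q P : Params d k) (e : (Fin n → Datum X Y) × S) : ℝ :=
  envelope l lam (linCond Φ P e.2) e.1 - envelope l lam (linCond Φ Q e.2) e.1

namespace ConvexLipschitzLoss

lemma abs_envelopeDiff_le (H : ConvexLipschitzLoss X Y l L R) (hlam : 0 < lam)
    {Q P : Params d k} {C : ℝ} (hC : ∀ s, ‖linCond Φ P s - linCond Φ Q s‖ ≤ C)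
    (e : (Fin n → Datum X Y) × S) : |envelopeDiff l lam Φ Q P e| ≤ L * R * C :=
  (H.abs_envelope_sub_le hlam _ _ _).trans (mul_le_mul_of_nonneg_left (hC _) H.mul_pos.le)

lemma frobSq_metaGrad_le (H : ConvexLipschitzLoss X Y l L R) (hlam : 0 < lam)
    (hΦ : ∀ s, ‖Φ s‖ ≤ K) (P : Params d k) (e : (Fin n → Datum X Y) × S) :
    frobSq (metaGrad l lam Φ P e) ≤ (L * R) ^ 2 * (K ^ 2 + 1) := by
  rw [metaGrad_eq, frobSq_rankOne]
  have h1 := H.norm_metaGrad_le hlam (linCond Φ P e.2) e.1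
  have h2 := hΦ e.2
  gcongr

/-- One step of the meta-algorithm. -/
lemma two_mul_envelope_sub_le (H : ConvexLipschitzLoss X Y l L R) (hlam : 0 < lam)
    (hΦ : ∀ s, ‖Φ s‖ ≤ K) {γ : ℝ} (hγ : 0 ≤ γ) (P Q : Params d k)
    (e : (Fin n → Datum X Y) × S) :
    2 * γ * (envelope l lam (linCond Φ P e.2) e.1 - envelope l lam (linCond Φ Q e.2) e.1)
      ≤ frobSq (P - Q) - frobSq (P - γ • metaGrad l lam Φ P e - Q)
        + γ ^ 2 * ((L * R) ^ 2 * (K ^ 2 + 1)) := by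
  have h1 := H.envelope_sub_le hlam (linCond Φ P e.2) (linCond Φ Q e.2) e.1
  have h2 := H.frobSq_metaGrad_le hlam hΦ P e
  have h3 := frobSq_sub_smul_rankOne (Φ := Φ) (P - Q) γ
    (-lam • (innerAlg l lam (linCond Φ P e.2) e.1 - linCond Φ P e.2)) e.2
  have hlin : linCond Φ (P - Q) e.2 = linCond Φ P e.2 - linCond Φ Q e.2 :=
    (linCondₗ Φ e.2).map_sub P Q
  rw [← metaGrad_eq, hlin] at h3
  rw [sub_right_comm, h3]
  have h4 := mul_le_mul_of_nonneg_left h2 (sq_nonneg γ)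
  have h5 := mul_le_mul_of_nonneg_left h1 (by positivity : 0 ≤ 2 * γ)
  linarith

/-- The regret bound of the meta-algorithm. -/
lemma two_mul_sum_envelope_sub_le (H : ConvexLipschitzLoss X Y l L R) (hlam : 0 < lam)
    (hΦ : ∀ s, ‖Φ s‖ ≤ K) {γ : ℝ} (hγ : 0 ≤ γ) (Q : Params d k)
    (e : ℕ → (Fin n → Datum X Y) × S) (T : ℕ) :
    2 * γ * ∑ t ∈ Finset.range T,
        (envelope l lam (linCond Φ (sgdIterate l lam γ Φ e t) (e t).2) (e t).1
          - envelope l lam (linCond Φ Q (e t).2) (e t).1)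
      ≤ frobSq Q + T * (γ ^ 2 * ((L * R) ^ 2 * (K ^ 2 + 1))) := by
  -- Retaining the final squared distance to `Q` makes the sum telescope in the induction.
  suffices h : 2 * γ * ∑ t ∈ Finset.range T,
        (envelope l lam (linCond Φ (sgdIterate l lam γ Φ e t) (e t).2) (e t).1
          - envelope l lam (linCond Φ Q (e t).2) (e t).1)
      ≤ frobSq Q - frobSq (sgdIterate l lam γ Φ e T - Q)
        + T * (γ ^ 2 * ((L * R) ^ 2 * (K ^ 2 + 1))) by
    have := frobSq_nonneg (sgdIterate l lam γ Φ e T - Q)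
    linarith
  induction T with
  | zero => simp [sgdIterate, frobSq_neg]
  | succ T ih =>
    rw [Finset.sum_range_succ, mul_add, Nat.cast_succ, add_mul, one_mul]
    have := H.two_mul_envelope_sub_le hlam hΦ hγ (sgdIterate l lam γ Φ e T) Q (e T)
    rw [sgdIterate]
    linarith

/-- The iterates of the meta-algorithm give uniformly bounded biases. -/
lemma norm_linCond_sgdIterate_le (H : ConvexLipschitzLoss X Y l L R) (hlam : 0 < lam)
    (hΦ : ∀ s, ‖Φ s‖ ≤ K) (γ : ℝ) (e : ℕ → (Fin n → Datum X Y) × S) (t : ℕ) (s : S) :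
    ‖linCond Φ (sgdIterate l lam γ Φ e t) s‖ ≤ t * (|γ| * ((K ^ 2 + 1) * (L * R))) := by
  induction t with
  | zero =>
    rw [sgdIterate, ← linCondₗ_apply, map_zero]
    simp
  | succ t ih =>
    rw [sgdIterate, ← linCondₗ_apply, map_sub, map_smul, linCondₗ_apply, linCondₗ_apply,
      metaGrad_eq, linCond_rankOne, Nat.cast_succ, add_mul, one_mul]
    refine (norm_sub_le _ _).trans (add_le_add ih ?_)
    rw [norm_smul, norm_smul, Real.norm_eq_abs, Real.norm_eq_abs]
    have h1 := H.norm_metaGrad_le hlam (linCond Φ (sgdIterate l lam γ Φ e t) (e t).2) (e t).1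
    have h2 : |⟪Φ (e t).2, Φ s⟫ + 1| ≤ K ^ 2 + 1 := by
      refine (abs_add_le _ _).trans ?_
      rw [abs_one]
      refine add_le_add_left ((abs_real_inner_le_norm _ _).trans ?_) _
      rw [sq]
      exact mul_le_mul (hΦ _) (hΦ _) (norm_nonneg _) ((norm_nonneg _).trans (hΦ s))
    gcongr

lemma norm_linCond_sgdOutput_le (H : ConvexLipschitzLoss X Y l L R) (hlam : 0 < lam)
    (hΦ : ∀ s, ‖Φ s‖ ≤ K) (γ : ℝ) {T : ℕ} (hT : 0 < T) (e : ℕ → (Fin n → Datum X Y) × S) (s : S) :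
    ‖linCond Φ (sgdOutput l lam γ Φ T e) s‖ ≤ T * (|γ| * ((K ^ 2 + 1) * (L * R))) := by
  have hT' : (0 : ℝ) < T := by exact_mod_cast hT
  rw [sgdOutput, ← linCondₗ_apply, map_smul, map_sum, norm_smul, Real.norm_eq_abs,
    abs_of_pos (by positivity), one_div, inv_mul_le_iff₀ hT']
  refine (norm_sum_le _ _).trans ((Finset.sum_le_card_nsmul _ _ (T * (|γ| * ((K ^ 2 + 1) * (L * R))))
    fun t ht => ?_).trans (by simp))
  refine (H.norm_linCond_sgdIterate_le hlam hΦ γ e t s).trans ?_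
  have : (t : ℝ) ≤ T := by exact_mod_cast (Finset.mem_range.1 ht).le
  have := H.mul_pos
  gcongr

/-- Jensen's inequality for the Moreau envelope. -/
lemma envelope_average_le (H : ConvexLipschitzLoss X Y l L R) (hlam : 0 < lam) {T : ℕ}
    (hT : 0 < T) (θ : ℕ → Vec d) (Z : Fin n → Datum X Y) :
    T * envelope l lam ((1 / (T : ℝ)) • ∑ t ∈ Finset.range T, θ t) Z
      ≤ ∑ t ∈ Finset.range T, envelope l lam (θ t) Z := by
  set θ₀ := (1 / (T : ℝ)) • ∑ t ∈ Finset.range T, θ t with hθ₀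
  have hT' : (T : ℝ) ≠ 0 := by exact_mod_cast hT.ne'
  -- All subgradient inequalities are based at the average `θ₀`; the linear terms cancel because the
  -- deviations `θ₀ - θ t` sum to zero.
  have h := Finset.sum_le_sum fun t (_ : t ∈ Finset.range T) => H.envelope_sub_le hlam θ₀ (θ t) Z
  have h0 : ∑ t ∈ Finset.range T, (θ₀ - θ t) = 0 := by
    rw [Finset.sum_sub_distrib, Finset.sum_const, Finset.card_range, hθ₀, ← Nat.cast_smul_eq_nsmul ℝ,
      smul_smul, mul_one_div_cancel hT', one_smul, sub_self]
  rw [← inner_sum, h0, inner_zero_right, Finset.sum_sub_distrib, Finset.sum_const,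
    Finset.card_range, nsmul_eq_mul] at h
  linarith

end ConvexLipschitzLoss

/-- The iterates of the meta-algorithm only depend on the data seen so far. -/
lemma sgdIterate_congr {γ : ℝ} {e e' : ℕ → (Fin n → Datum X Y) × S} {t : ℕ}
    (h : ∀ i < t, e i = e' i) : sgdIterate l lam γ Φ e t = sgdIterate l lam γ Φ e' t := by
  induction t with
  | zero => rfl
  | succ t ih =>
    rw [sgdIterate, sgdIterate, ih fun i hi => h i (hi.trans t.lt_succ_self), h t t.lt_succ_self]

lemma exists_norm_linCond_le (hΦ : ∀ s, ‖Φ s‖ ≤ K) (Q : Params d k) :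
    ∃ C, ∀ s, ‖linCond Φ Q s‖ ≤ C := by
  refine ⟨‖LinearMap.toContinuousLinearMap (Matrix.toEuclideanLin Q.1)‖ * K + ‖Q.2‖, fun s => ?_⟩
  refine (norm_add_le _ _).trans (add_le_add_left ?_ _)
  exact ((LinearMap.toContinuousLinearMap (Matrix.toEuclideanLin Q.1)).le_opNorm (Φ s)).trans
    (mul_le_mul_of_nonneg_left (hΦ s) (norm_nonneg _))

lemma eq_zero_of_frobNorm_eq_zero {Q : Params d k} (h : frobNorm Q = 0) : Q = 0 := by
  have h0 : frobSq Q = 0 := by rw [← frobNorm_sq, h, sq, zero_mul]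
  have h1 : 0 ≤ ∑ i, ∑ j, Q.1 i j ^ 2 := by positivity
  have h2 : 0 ≤ ‖Q.2‖ ^ 2 := by positivity
  have h3 : ∑ i, ∑ j, Q.1 i j ^ 2 = 0 := by rw [frobSq] at h0; linarith
  have h4 : ‖Q.2‖ ^ 2 = 0 := by rw [frobSq] at h0; linarith
  refine Prod.ext ?_ (norm_eq_zero.1 (pow_eq_zero_iff two_ne_zero |>.1 h4))
  ext i j
  have h5 := (Finset.sum_eq_zero_iff_of_nonneg fun i _ => by positivity).1 h3 i (Finset.mem_univ i)
  have h6 := (Finset.sum_eq_zero_iff_of_nonneg fun j _ => by positivity).1 h5 j (Finset.mem_univ j)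
  exact pow_eq_zero_iff two_ne_zero |>.1 h6

lemma sgdIterate_zero_step (e : ℕ → (Fin n → Datum X Y) × S) (t : ℕ) :
    sgdIterate l lam 0 Φ e t = 0 := by
  induction t with
  | zero => rfl
  | succ t ih => rw [sgdIterate, ih, zero_smul, sub_zero]

lemma ConvexLipschitzLoss.sum_envelopeDiff_le (H : ConvexLipschitzLoss X Y l L R) (hlam : 0 < lam) {T : ℕ} (hT : 0 < T)
    (hΦ : ∀ s, ‖Φ s‖ ≤ K) (Q : Params d k) {γ : ℝ}
    (hγ : γ = frobNorm Q / (L * R * Real.sqrt (K ^ 2 + 1)) * (1 / Real.sqrt T))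
    (e : ℕ → (Fin n → Datum X Y) × S) :
    ∑ t ∈ Finset.range T, envelopeDiff l lam Φ Q (sgdIterate l lam γ Φ e t) (e t)
      ≤ T * (L * R * Real.sqrt (K ^ 2 + 1) * frobNorm Q / Real.sqrt T) := by
  have hT' : (0 : ℝ) < T := by exact_mod_cast hT
  have hsT := Real.sqrt_pos.2 hT'
  have hsT2 := Real.sq_sqrt hT'.le
  have hK : 0 < K ^ 2 + 1 := by positivity
  have hsK := Real.sqrt_pos.2 hK
  have hsK2 := Real.sq_sqrt hK.le
  have hLR := H.mul_pos
  have hF : 0 ≤ frobNorm Q := Real.sqrt_nonneg _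
  set F := frobNorm Q with hFdef
  set sT := Real.sqrt T
  set sK := Real.sqrt (K ^ 2 + 1)
  -- If `Q = 0` the step size is zero, so every iterate equals `Q` and the regret vanishes.
  -- Otherwise one may divide by `2 γ`.
  rcases hF.eq_or_lt with h0 | h0
  · have hQ : Q = 0 := eq_zero_of_frobNorm_eq_zero h0.symm
    have hγ0 : γ = 0 := by rw [hγ, ← h0]; simp
    subst hγ0
    rw [← h0, mul_zero, zero_div, mul_zero]
    refine (Finset.sum_eq_zero fun t _ => ?_).le
    rw [sgdIterate_zero_step, hQ, envelopeDiff, sub_self]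
  · have hγpos : 0 < γ := by rw [hγ]; positivity
    have h := H.two_mul_sum_envelope_sub_le hlam hΦ hγpos.le Q e T
    rw [← frobNorm_sq, ← hFdef, ← hsK2] at h
    -- With this step size, `F²` equals the accumulated squared-gradient term `T γ² (L R)² (K² +
    -- 1)`.
    have hγF : γ * (L * R * sK * sT) = F := by
      rw [hγ, one_div, ← div_eq_mul_inv, div_div, div_mul_cancel₀ _ (by positivity)]
    refine le_of_mul_le_mul_left (h.trans (le_of_eq ?_)) (by positivity : 0 < 2 * γ)
    rw [← hsT2, ← hγF]
    field_simp
    ring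

end Regret

/-! ### Transfer risk: integrability and reduction to the envelope -/

section TransferRisk

variable {d k n : ℕ} {X : Set (Vec d)} {Y : Set ℝ} {l : ℝ → ℝ → ℝ} {L R K lam : ℝ}
  {S : Type*} [MeasurableSpace S] {Φ : S → EuclideanSpace ℝ (Fin k)}
  {ρ : Measure (LearningTask X Y × S)} [IsProbabilityMeasure ρ]
  {wstar : LearningTask X Y → Vec d}

instance : IsProbabilityMeasure (episodeLaw ρ n) :=
  inferInstanceAs (IsProbabilityMeasure (ρ ⊗ₘ datasetKernel X Y S n))

lemma measurable_observation :
    Measurable fun q : (LearningTask X Y × S) × (Fin n → Datum X Y) => (q.2, q.1.2) :=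
  measurable_snd.prodMk measurable_fst.snd

instance : IsProbabilityMeasure (sampleLaw ρ n) :=
  Measure.isProbabilityMeasure_map measurable_observation.aemeasurable

lemma measurePreserving_fst_episodeLaw :
    MeasurePreserving (Prod.fst : _ × (Fin n → Datum X Y) → _) (episodeLaw ρ n) ρ :=
  ⟨measurable_fst, Measure.fst_compProd ρ (datasetKernel X Y S n)⟩

namespace ConvexLipschitzLoss

lemma abs_risk_sub_le (H : ConvexLipschitzLoss X Y l L R) {μ : LearningTask X Y}
    (hint : ∀ w, Integrable (lossAt l w) (μ : Measure (Datum X Y))) (w w' : Vec d) :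
    |risk l μ w - risk l μ w'| ≤ L * R * ‖w - w'‖ := by
  rw [risk, risk, ← integral_sub (hint w) (hint w'), ← Real.norm_eq_abs]
  have := norm_integral_le_of_norm_le_const (μ := (μ : Measure (Datum X Y)))
    (f := fun z => lossAt l w z - lossAt l w' z)
    (Eventually.of_forall fun z => H.abs_lossAt_sub_le z w w')
  simpa using this

/-- The path from the output to `w` passes through `θ` and `θ'`. Replacing `‖w - θ'‖` by `‖w - θ'‖²
+ 1` leaves a bound whose integrability needs only the ideal risk and the finite variance. -/
lemma abs_risk_innerAlg_le (H : ConvexLipschitzLoss X Y l L R) (hlam : 0 < lam)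
    {μ : LearningTask X Y} (hint : ∀ w, Integrable (lossAt l w) (μ : Measure (Datum X Y)))
    (w θ θ' : Vec d) (Z : Fin n → Datum X Y) :
    |risk l μ (innerAlg l lam θ Z)|
      ≤ |risk l μ w| + L * R * (L * R / lam + ‖θ - θ'‖ + (‖w - θ'‖ ^ 2 + 1)) := by
  have h1 := H.abs_risk_sub_le hint (innerAlg l lam θ Z) w
  have h2 := abs_sub_abs_le_abs_sub (risk l μ (innerAlg l lam θ Z)) (risk l μ w)
  have h3 : ‖innerAlg l lam θ Z - w‖ ≤ L * R / lam + ‖θ - θ'‖ + (‖w - θ'‖ ^ 2 + 1) := by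
    have e : innerAlg l lam θ Z - w = (innerAlg l lam θ Z - θ) + (θ - θ') - (w - θ') := by abel
    rw [e]
    refine (norm_sub_le _ _).trans (add_le_add ((norm_add_le _ _).trans
      (add_le_add_left (H.norm_innerAlg_sub_le_div hlam θ Z) _)) ?_)
    nlinarith [sq_nonneg (‖w - θ'‖ - 1)]
  have h4 := mul_le_mul_of_nonneg_left h3 H.mul_pos.le
  linarith

lemma measurable_episodeRisk (H : ConvexLipschitzLoss X Y l L R) (hlam : 0 < lam) {α : Type*}
    [MeasurableSpace α] (hΦ : Measurable Φ) {P : α → Params d k} (hP : Measurable P) :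
    Measurable fun a : α × ((LearningTask X Y × S) × (Fin n → Datum X Y)) =>
      episodeRisk l lam (linCond Φ (P a.1)) a.2 := by
  refine H.measurable_risk measurable_snd.fst.fst (H.measurable_innerAlg hlam ?_ measurable_snd.snd)
  exact measurable_linCond hΦ (hP.comp measurable_fst) measurable_snd.fst.snd

/-- A dominating function for the risks of all bounded perturbations of a comparator. -/
lemma abs_episodeRisk_le (H : ConvexLipschitzLoss X Y l L R) (hlam : 0 < lam)
    (hrisk : ∀ᵐ p ∂ρ, ∀ w : Vec d, Integrable (lossAt l w) (p.1 : Measure (Datum X Y)))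
    (wstar : LearningTask X Y → Vec d) (τ' : S → Vec d) (C : ℝ) :
    ∀ᵐ q ∂(episodeLaw ρ n), ∀ τ : S → Vec d, (∀ s, ‖τ s - τ' s‖ ≤ C) →
      |episodeRisk l lam τ q| ≤ |risk l q.1.1 (wstar q.1.1)|
        + L * R * (L * R / lam + C + (‖wstar q.1.1 - τ' q.1.2‖ ^ 2 + 1)) := by
  filter_upwards [measurePreserving_fst_episodeLaw.quasiMeasurePreserving.ae hrisk]
    with q hq τ hτ
  refine (H.abs_risk_innerAlg_le hlam hq (wstar q.1.1) _ (τ' q.1.2) _).trans ?_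
  have := hτ q.1.2
  have := H.mul_pos
  gcongr

lemma integrable_dominating (C : ℝ) {τ' : S → Vec d}
    (hideal : Integrable (fun p : LearningTask X Y × S => risk l p.1 (wstar p.1)) ρ)
    (hvar : Integrable (fun p : LearningTask X Y × S => ‖wstar p.1 - τ' p.2‖ ^ 2) ρ) :
    Integrable (fun q : (LearningTask X Y × S) × (Fin n → Datum X Y) =>
      |risk l q.1.1 (wstar q.1.1)|
        + L * R * (L * R / lam + C + (‖wstar q.1.1 - τ' q.1.2‖ ^ 2 + 1))) (episodeLaw ρ n) :=
  measurePreserving_fst_episodeLaw.integrable_comp_of_integrable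
    (g := fun p : LearningTask X Y × S => |risk l p.1 (wstar p.1)|
        + L * R * (L * R / lam + C + (‖wstar p.1 - τ' p.2‖ ^ 2 + 1)))
    (hideal.abs.add (((integrable_const _).add (hvar.add (integrable_const _))).const_mul _))

lemma integrable_episodeRisk (H : ConvexLipschitzLoss X Y l L R) (hlam : 0 < lam)
    (hΦ : Measurable Φ)
    (hrisk : ∀ᵐ p ∂ρ, ∀ w : Vec d, Integrable (lossAt l w) (p.1 : Measure (Datum X Y)))
    (hideal : Integrable (fun p : LearningTask X Y × S => risk l p.1 (wstar p.1)) ρ)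
    {Q : Params d k}
    (hvar : Integrable (fun p : LearningTask X Y × S => ‖wstar p.1 - linCond Φ Q p.2‖ ^ 2) ρ)
    {P : Params d k} {C : ℝ} (hC : ∀ s, ‖linCond Φ P s - linCond Φ Q s‖ ≤ C) :
    Integrable (episodeRisk l lam (linCond Φ P)) (episodeLaw ρ n) := by
  refine (integrable_dominating (L := L) (R := R) (lam := lam) C hideal hvar).mono' ?_ ?_
  · exact ((H.measurable_episodeRisk hlam hΦ (α := Unit) (P := fun _ => P)
      measurable_const).comp ((measurable_const (a := ())).prodMk measurable_id)).aestronglyMeasurable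
      (f := fun q => episodeRisk l lam (linCond Φ P) q)
  · filter_upwards [H.abs_episodeRisk_le hlam hrisk wstar (linCond Φ Q) C] with q hq
    exact hq _ hC

lemma integrable_transferRisk (H : ConvexLipschitzLoss X Y l L R) (hlam : 0 < lam)
    (hΦ : Measurable Φ)
    (hrisk : ∀ᵐ p ∂ρ, ∀ w : Vec d, Integrable (lossAt l w) (p.1 : Measure (Datum X Y)))
    (hideal : Integrable (fun p : LearningTask X Y × S => risk l p.1 (wstar p.1)) ρ)
    {Q : Params d k}
    (hvar : Integrable (fun p : LearningTask X Y × S => ‖wstar p.1 - linCond Φ Q p.2‖ ^ 2) ρ)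
    {Ω : Type*} [MeasurableSpace Ω] (ν : Measure Ω) [IsProbabilityMeasure ν]
    {P : Ω → Params d k} (hP : Measurable P) {C : ℝ}
    (hC : ∀ ω s, ‖linCond Φ (P ω) s - linCond Φ Q s‖ ≤ C) :
    Integrable (fun ω => transferRisk l lam ρ n (linCond Φ (P ω))) ν := by
  have hmeas : StronglyMeasurable fun ω => transferRisk l lam ρ n (linCond Φ (P ω)) :=
    StronglyMeasurable.integral_prod_right' (ν := episodeLaw ρ n)
      (f := fun a : Ω × ((LearningTask X Y × S) × (Fin n → Datum X Y)) =>
        episodeRisk l lam (linCond Φ (P a.1)) a.2)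
      (H.measurable_episodeRisk hlam hΦ hP).stronglyMeasurable
  have hbound : ∀ ω, ‖transferRisk l lam ρ n (linCond Φ (P ω))‖
      ≤ ∫ q : (LearningTask X Y × S) × (Fin n → Datum X Y), (|risk l q.1.1 (wstar q.1.1)|
        + L * R * (L * R / lam + C + (‖wstar q.1.1 - linCond Φ Q q.1.2‖ ^ 2 + 1)))
        ∂(episodeLaw ρ n) := by
    intro ω
    refine norm_integral_le_of_norm_le (integrable_dominating C hideal hvar) ?_
    filter_upwards [H.abs_episodeRisk_le hlam hrisk wstar (linCond Φ Q) C] with q hq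
    exact hq _ (hC ω)
  exact Integrable.of_bound hmeas.aestronglyMeasurable _ (Eventually.of_forall hbound)

lemma measurable_envelopeDiff (H : ConvexLipschitzLoss X Y l L R) (hlam : 0 < lam)
    (hΦ : Measurable Φ) (Q : Params d k) {α : Type*} [MeasurableSpace α] {P : α → Params d k}
    (hP : Measurable P) {e : α → (Fin n → Datum X Y) × S} (he : Measurable e) :
    Measurable fun a => envelopeDiff l lam Φ Q (P a) (e a) :=
  (H.measurable_envelope hlam (measurable_linCond hΦ hP he.snd) he.fst).sub
    (H.measurable_envelope hlam (measurable_linCond hΦ measurable_const he.snd) he.fst)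

lemma integrable_envelopeDiff (H : ConvexLipschitzLoss X Y l L R) (hlam : 0 < lam)
    (hΦ : Measurable Φ) (Q : Params d k) {α : Type*} [MeasurableSpace α] {ν : Measure α}
    [IsFiniteMeasure ν] {P : α → Params d k} (hP : Measurable P) {C : ℝ}
    (hC : ∀ a s, ‖linCond Φ (P a) s - linCond Φ Q s‖ ≤ C)
    {e : α → (Fin n → Datum X Y) × S} (he : Measurable e) :
    Integrable (fun a => envelopeDiff l lam Φ Q (P a) (e a)) ν :=
  Integrable.of_bound (H.measurable_envelopeDiff hlam hΦ Q hP he).aestronglyMeasurable _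
    (Eventually.of_forall fun a => H.abs_envelopeDiff_le hlam (hC a) (e a))

/-- The excess transfer risk is controlled by the excess of the expected Moreau envelope. -/
lemma transferRisk_sub_idealRisk_le (H : ConvexLipschitzLoss X Y l L R) (hlam : 0 < lam)
    (hn : 0 < n) (hΦ : Measurable Φ)
    (hrisk : ∀ᵐ p ∂ρ, ∀ w : Vec d, Integrable (lossAt l w) (p.1 : Measure (Datum X Y)))
    (hideal : Integrable (fun p : LearningTask X Y × S => risk l p.1 (wstar p.1)) ρ)
    {Q : Params d k}
    (hvar : Integrable (fun p : LearningTask X Y × S => ‖wstar p.1 - linCond Φ Q p.2‖ ^ 2) ρ)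
    {P : Params d k} {C : ℝ} (hC : ∀ s, ‖linCond Φ P s - linCond Φ Q s‖ ≤ C) :
    transferRisk l lam ρ n (linCond Φ P) - idealRisk l ρ wstar
      ≤ ∫ e, envelopeDiff l lam Φ Q P e ∂(sampleLaw ρ n)
        + lam / 2 * stdVar ρ wstar (linCond Φ Q) ^ 2 + 2 * (L * R) ^ 2 / (lam * n) := by
  have hER := H.integrable_episodeRisk (n := n) hlam hΦ hrisk hideal hvar hC
  have hED : Integrable (fun q : (LearningTask X Y × S) × (Fin n → Datum X Y) =>
      envelopeDiff l lam Φ Q P (q.2, q.1.2)) (episodeLaw ρ n) :=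
    H.integrable_envelopeDiff hlam hΦ Q measurable_const (fun _ => hC) measurable_observation
  have hmeas : Measurable fun e : (Fin n → Datum X Y) × S => envelopeDiff l lam Φ Q P e :=
    H.measurable_envelopeDiff hlam hΦ Q measurable_const measurable_id
  have hT : transferRisk l lam ρ n (linCond Φ P) = ∫ p, ∫ Z : Fin n → Datum X Y,
      risk l p.1 (innerAlg l lam (linCond Φ P p.2) Z)
        ∂(Measure.pi fun _ => (p.1 : Measure (Datum X Y))) ∂ρ :=
    Measure.integral_compProd hER
  have hD : ∫ e, envelopeDiff l lam Φ Q P e ∂(sampleLaw ρ n) = ∫ p, ∫ Z : Fin n → Datum X Y,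
      (envelope l lam (linCond Φ P p.2) Z - envelope l lam (linCond Φ Q p.2) Z)
        ∂(Measure.pi fun _ => (p.1 : Measure (Datum X Y))) ∂ρ := by
    rw [sampleLaw, integral_map measurable_observation.aemeasurable hmeas.aestronglyMeasurable]
    exact Measure.integral_compProd hED
  have hTI : Integrable (fun p : LearningTask X Y × S => ∫ Z : Fin n → Datum X Y,
      risk l p.1 (innerAlg l lam (linCond Φ P p.2) Z)
        ∂(Measure.pi fun _ => (p.1 : Measure (Datum X Y)))) ρ := hER.integral_compProd
  have hDI : Integrable (fun p : LearningTask X Y × S => ∫ Z : Fin n → Datum X Y,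
      (envelope l lam (linCond Φ P p.2) Z - envelope l lam (linCond Φ Q p.2) Z)
        ∂(Measure.pi fun _ => (p.1 : Measure (Datum X Y)))) ρ := hED.integral_compProd
  have hV : stdVar ρ wstar (linCond Φ Q) ^ 2 = ∫ p, ‖wstar p.1 - linCond Φ Q p.2‖ ^ 2 ∂ρ :=
    Real.sq_sqrt (integral_nonneg fun _ => by positivity)
  have hRI : Integrable (fun p : LearningTask X Y × S => risk l p.1 (wstar p.1)
      + lam / 2 * ‖wstar p.1 - linCond Φ Q p.2‖ ^ 2) ρ := hideal.add (hvar.const_mul _)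
  -- The single-task bound, with the target vector as comparison vector and `τ_Q(s)` as comparison
  -- bias, integrated over the environment.
  have hle := integral_mono_ae hTI ((hDI.add hRI).add (integrable_const
      (2 * (L * R) ^ 2 / (lam * n)))) (by
    filter_upwards [hrisk] with p hp
    exact H.integral_risk_le hlam hn (linCond Φ P p.2) (linCond Φ Q p.2) (wstar p.1) hp)
  rw [integral_add' (hDI.add hRI) (integrable_const _), integral_add' hDI hRI,
    integral_add hideal (hvar.const_mul _), integral_const_mul, ← hV, ← hD, ← hT] at hle
  simp only [integral_const, probReal_univ, one_smul] at hle
  rw [idealRisk]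
  linarith

end ConvexLipschitzLoss

end TransferRisk

/-! ### From regret to expected excess over independent samples -/

section Expectation

variable {d k n T : ℕ} {X : Set (Vec d)} {Y : Set ℝ} {l : ℝ → ℝ → ℝ} {L R K lam γ : ℝ}
  {S : Type*} [MeasurableSpace S] {Φ : S → EuclideanSpace ℝ (Fin k)}
  {ρ : Measure (LearningTask X Y × S)} [IsProbabilityMeasure ρ]
  {Ω : Type*} [MeasurableSpace Ω] {P : Measure Ω} [IsProbabilityMeasure P]
  {e : ℕ → Ω → (Fin n → Datum X Y) × S}

/-- Fubini's theorem for a function of two independent random variables. -/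
lemma integral_indepFun_prod {Ω α β : Type*} [MeasurableSpace Ω] [MeasurableSpace α]
    [MeasurableSpace β] {P : Measure Ω} [IsProbabilityMeasure P] {f : Ω → α} {g : Ω → β}
    (hf : Measurable f) (hg : Measurable g) (hfg : IndepFun f g P) {D : α × β → ℝ}
    (hD : Measurable D) (hint : Integrable (fun ω => D (f ω, g ω)) P) :
    Integrable (fun ω => ∫ b, D (f ω, b) ∂(P.map g)) P ∧
      ∫ ω, D (f ω, g ω) ∂P = ∫ ω, ∫ b, D (f ω, b) ∂(P.map g) ∂P := by
  have := Measure.isProbabilityMeasure_map (μ := P) hg.aemeasurable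
  have := Measure.isProbabilityMeasure_map (μ := P) hf.aemeasurable
  have hprod := (indepFun_iff_map_prod_eq_prod_map_map hf.aemeasurable hg.aemeasurable).1 hfg
  have hfgm : Measurable fun ω => (f ω, g ω) := hf.prodMk hg
  have hint' : Integrable D ((P.map f).prod (P.map g)) := by
    rw [← hprod, integrable_map_measure hD.aestronglyMeasurable hfgm.aemeasurable]
    exact hint
  have hmeas : StronglyMeasurable fun a => ∫ b, D (a, b) ∂(P.map g) :=
    hD.stronglyMeasurable.integral_prod_right'
  refine ⟨(integrable_map_measure hmeas.aestronglyMeasurable hf.aemeasurable).1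
    hint'.integral_prod_left, ?_⟩
  rw [← integral_map hfgm.aemeasurable hD.aestronglyMeasurable, hprod, integral_prod _ hint',
    integral_map hf.aemeasurable hmeas.aestronglyMeasurable]

/-- An iterate of the meta-algorithm is independent of the data that come next. -/
lemma indepFun_sgdIterate (H : ConvexLipschitzLoss X Y l L R) (hlam : 0 < lam)
    (hΦ : Measurable Φ) (γ : ℝ) (hemeas : ∀ t < T, Measurable (e t))
    (heindep : iIndepFun (fun t : Fin T => e t) P) {t : ℕ} (ht : t < T) :
    IndepFun (fun ω => sgdIterate l lam γ Φ (fun i => e i ω) t) (e t) P := by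
  classical
  obtain ⟨ω₀⟩ : Nonempty Ω := nonempty_of_isProbabilityMeasure P
  let A : Finset (Fin T) := Finset.univ.filter fun i => (i : ℕ) < t
  let B : Finset (Fin T) := {⟨t, ht⟩}
  have hAB : Disjoint A B := by simp [A, B]
  have hind := heindep.indepFun_finset A B hAB fun i => hemeas i i.2
  -- Extends the first `t` observations to a full sequence. The constant filler `e t ω₀` is
  -- irrelevant, because the `t`-th iterate reads only indices below `t`.
  let ext : (A → (Fin n → Datum X Y) × S) → ℕ → (Fin n → Datum X Y) × S := fun u i =>
    if h : i < t then u ⟨⟨i, h.trans ht⟩, by simp [A, h]⟩ else e t ω₀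
  have hext : ∀ i, Measurable fun u => ext u i := by
    intro i
    by_cases h : i < t
    · simp only [ext, h, dif_pos]
      exact measurable_pi_apply _
    · simp only [ext, h, dif_neg, not_false_eq_true]
      exact measurable_const
  have hiter : Measurable fun u => sgdIterate l lam γ Φ (ext u) t :=
    measurable_sgdIterate H hlam hΦ γ (e := fun i u => ext u i) t fun i _ => hext i
  have hlast : Measurable fun u : B → (Fin n → Datum X Y) × S =>
      u ⟨⟨t, ht⟩, Finset.mem_singleton_self _⟩ := measurable_pi_apply _
  have := hind.comp hiter hlast
  have heq : (fun ω => sgdIterate l lam γ Φ (fun i => e i ω) t)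
      = (fun u => sgdIterate l lam γ Φ (ext u) t) ∘ fun ω (i : A) => e i ω :=
    funext fun ω => sgdIterate_congr fun i hi => by simp [ext, hi]
  rw [heq]
  exact this

/-- The expected excess of the Moreau envelope at the output of the meta-algorithm. -/
lemma integral_envelopeDiff_sgdOutput_le (H : ConvexLipschitzLoss X Y l L R) (hlam : 0 < lam)
    (hT : 0 < T) (hΦmeas : Measurable Φ) (hΦ : ∀ s, ‖Φ s‖ ≤ K) (Q : Params d k)
    (hγ : γ = frobNorm Q / (L * R * Real.sqrt (K ^ 2 + 1)) * (1 / Real.sqrt T))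
    (hemeas : ∀ t < T, Measurable (e t)) (heindep : iIndepFun (fun t : Fin T => e t) P)
    (helaw : ∀ t < T, P.map (e t) = sampleLaw ρ n) :
    Integrable (fun ω => ∫ x, envelopeDiff l lam Φ Q (sgdOutput l lam γ Φ T fun t => e t ω) x
      ∂(sampleLaw ρ n)) P ∧
    ∫ ω, ∫ x, envelopeDiff l lam Φ Q (sgdOutput l lam γ Φ T fun t => e t ω) x
      ∂(sampleLaw ρ n) ∂P ≤ L * R * Real.sqrt (K ^ 2 + 1) * frobNorm Q / Real.sqrt T := by
  obtain ⟨CQ, hCQ⟩ := exists_norm_linCond_le (d := d) hΦ Q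
  have hT' : (0 : ℝ) < T := by exact_mod_cast hT
  let iter : ℕ → Ω → Params d k := fun t ω => sgdIterate l lam γ Φ (fun i => e i ω) t
  let out : Ω → Params d k := fun ω => sgdOutput l lam γ Φ T fun i => e i ω
  have hiter_meas : ∀ t < T, Measurable (iter t) := fun t ht =>
    measurable_sgdIterate H hlam hΦmeas γ t fun i hi => hemeas i (hi.trans ht)
  have hout_meas : Measurable out := measurable_sgdOutput H hlam hΦmeas γ hemeas
  have hCiter : ∀ t ω s, ‖linCond Φ (iter t ω) s - linCond Φ Q s‖
      ≤ t * (|γ| * ((K ^ 2 + 1) * (L * R))) + CQ := fun t ω s =>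
    (norm_sub_le _ _).trans (add_le_add (H.norm_linCond_sgdIterate_le hlam hΦ γ _ t s) (hCQ s))
  have hCout : ∀ ω s, ‖linCond Φ (out ω) s - linCond Φ Q s‖
      ≤ T * (|γ| * ((K ^ 2 + 1) * (L * R))) + CQ := fun ω s =>
    (norm_sub_le _ _).trans (add_le_add (H.norm_linCond_sgdOutput_le hlam hΦ γ hT _ s) (hCQ s))
  -- Since the iterate is independent of the sample it meets next, its expected online loss equals
  -- its expected population loss.
  have hstep : ∀ t < T, Integrable (fun ω => ∫ x, envelopeDiff l lam Φ Q (iter t ω) x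
        ∂(sampleLaw ρ n)) P ∧
      ∫ ω, envelopeDiff l lam Φ Q (iter t ω) (e t ω) ∂P
        = ∫ ω, ∫ x, envelopeDiff l lam Φ Q (iter t ω) x ∂(sampleLaw ρ n) ∂P := by
    intro t ht
    rw [← helaw t ht]
    exact integral_indepFun_prod (hiter_meas t ht) (hemeas t ht)
      (indepFun_sgdIterate H hlam hΦmeas γ hemeas heindep ht)
      (D := fun q => envelopeDiff l lam Φ Q q.1 q.2)
      (H.measurable_envelopeDiff hlam hΦmeas Q measurable_fst measurable_snd)
      (H.integrable_envelopeDiff hlam hΦmeas Q (hiter_meas t ht) (hCiter t) (hemeas t ht))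
  have hout_int : Integrable (fun ω => ∫ x, envelopeDiff l lam Φ Q (out ω) x
      ∂(sampleLaw ρ n)) P := by
    have hm : StronglyMeasurable fun ω => ∫ x, envelopeDiff l lam Φ Q (out ω) x
        ∂(sampleLaw ρ n) :=
      StronglyMeasurable.integral_prod_right' (ν := sampleLaw ρ n)
        (f := fun q : Ω × ((Fin n → Datum X Y) × S) => envelopeDiff l lam Φ Q (out q.1) q.2)
        (H.measurable_envelopeDiff hlam hΦmeas Q (hout_meas.comp measurable_fst)
          measurable_snd).stronglyMeasurable
    refine Integrable.of_bound hm.aestronglyMeasurable _ (Eventually.of_forall fun ω =>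
      norm_integral_le_of_norm_le_const
        (Eventually.of_forall fun x => H.abs_envelopeDiff_le hlam (hCout ω) x))
  refine ⟨hout_int, ?_⟩
  have hjensen : ∀ ω, T * ∫ x, envelopeDiff l lam Φ Q (out ω) x ∂(sampleLaw ρ n)
      ≤ ∑ t ∈ Finset.range T, ∫ x, envelopeDiff l lam Φ Q (iter t ω) x ∂(sampleLaw ρ n) := by
    intro ω
    have hi : ∀ t, Integrable (fun x => envelopeDiff l lam Φ Q (iter t ω) x) (sampleLaw ρ n) :=
      fun t => H.integrable_envelopeDiff hlam hΦmeas Q measurable_const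
        (fun _ => hCiter t ω) measurable_id
    have ho : Integrable (fun x => envelopeDiff l lam Φ Q (out ω) x) (sampleLaw ρ n) :=
      H.integrable_envelopeDiff hlam hΦmeas Q measurable_const (fun _ => hCout ω) measurable_id
    rw [← integral_const_mul, ← integral_finsetSum _ fun t _ => hi t]
    refine integral_mono (ho.const_mul _) (integrable_finsetSum _ fun t _ => hi t) fun x => ?_
    have h := H.envelope_average_le hlam hT (fun t => linCond Φ (iter t ω) x.2) x.1
    have hlin : linCond Φ (out ω) x.2
        = (1 / (T : ℝ)) • ∑ t ∈ Finset.range T, linCond Φ (iter t ω) x.2 := by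
      change linCondₗ Φ x.2 ((1 / (T : ℝ)) • ∑ t ∈ Finset.range T, iter t ω) = _
      rw [map_smul, map_sum]
      rfl
    simp only [envelopeDiff, hlin, Finset.sum_sub_distrib, Finset.sum_const, Finset.card_range,
      nsmul_eq_mul, mul_sub]
    linarith
  have h1 := integral_mono (hout_int.const_mul (T : ℝ))
    (integrable_finsetSum _ fun t ht => (hstep t (Finset.mem_range.1 ht)).1) hjensen
  rw [integral_const_mul,
    integral_finsetSum _ fun t ht => (hstep t (Finset.mem_range.1 ht)).1,
    ← Finset.sum_congr rfl fun t ht => (hstep t (Finset.mem_range.1 ht)).2] at h1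
  have hDint : ∀ t ∈ Finset.range T,
      Integrable (fun ω => envelopeDiff l lam Φ Q (iter t ω) (e t ω)) P := fun t ht =>
    H.integrable_envelopeDiff hlam hΦmeas Q (hiter_meas t (Finset.mem_range.1 ht)) (hCiter t)
      (hemeas t (Finset.mem_range.1 ht))
  rw [← integral_finsetSum _ hDint] at h1
  -- The regret bound holds for every realization, hence in expectation.
  have h2 := integral_mono (integrable_finsetSum _ hDint) (integrable_const _)
    fun ω => H.sum_envelopeDiff_le hlam hT hΦ Q hγ fun i => e i ω
  rw [integral_const, probReal_univ, one_smul] at h2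
  exact le_of_mul_le_mul_left (h1.trans h2) hT'

end Expectation

end CondMeta

/-! ### Assembly with the prescribed hyper-parameters -/

theorem mainTheorem2 {d k n T : ℕ} (hn : 0 < n) (hT : 0 < T)
    (X : Set (Vec d)) (Y : Set ℝ) {S : Type*} [MeasurableSpace S]
    -- the loss is convex and `L`-Lipschitz in its first argument, and the inputs are bounded
    (l : ℝ → ℝ → ℝ) (hlmeas : Measurable (Function.uncurry l))
    (L R K : ℝ) (hL : 0 < L) (hR : 0 < R) (hK : 0 < K)
    (hconv : ∀ y ∈ Y, ConvexOn ℝ Set.univ (fun a => l a y))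
    (hlip : ∀ y ∈ Y, ∀ a a' : ℝ, |l a y - l a' y| ≤ L * |a - a'|)
    (hX : ∀ x ∈ X, ‖x‖ ≤ R)
    -- the feature map is bounded
    (Φ : S → EuclideanSpace ℝ (Fin k)) (hΦmeas : Measurable Φ) (hΦ : ∀ s, ‖Φ s‖ ≤ K)
    -- the environment, the target vectors, and the existence of the ideal risk
    (ρ : Measure (LearningTask X Y × S)) [IsProbabilityMeasure ρ]
    (hrisk : ∀ᵐ p ∂ρ, ∀ w : Vec d, Integrable (lossAt l w) (p.1 : Measure (Datum X Y)))
    (wstar : LearningTask X Y → Vec d)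
    (hwstar : ∀ᵐ p ∂ρ, IsMinOn (risk l p.1) Set.univ (wstar p.1))
    (hideal : Integrable (fun p : LearningTask X Y × S => risk l p.1 (wstar p.1)) ρ)
    -- the comparison function `τ_{M,b}`, of finite and nonzero variance
    (M : Matrix (Fin d) (Fin k) ℝ) (b : Vec d)
    (hvar : Integrable (fun p : LearningTask X Y × S => ‖wstar p.1 - linCond Φ (M, b) p.2‖ ^ 2) ρ)
    (hvarpos : 0 < stdVar ρ wstar (linCond Φ (M, b)))
    -- the hyper-parameters
    (lam γ : ℝ)
    (hlam : lam = 2 * R * L / stdVar ρ wstar (linCond Φ (M, b)) * (1 / Real.sqrt n))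
    (hγ : γ = frobNorm (M, b) / (L * R * Real.sqrt (K ^ 2 + 1)) * (1 / Real.sqrt T))
    -- the i.i.d. training pairs `(Z_t, s_t)`, `t < T`
    {Ω : Type*} [MeasurableSpace Ω] (P : Measure Ω) [IsProbabilityMeasure P]
    (e : ℕ → Ω → (Fin n → Datum X Y) × S)
    (hemeas : ∀ t < T, Measurable (e t))
    (heindep : iIndepFun (fun t : Fin T => e t) P)
    (helaw : ∀ t < T, P.map (e t) = sampleLaw ρ n) :
    (∀ ω, Integrable
      (episodeRisk l lam (linCond Φ (sgdOutput l lam γ Φ T fun t => e t ω))) (episodeLaw ρ n)) ∧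
    Integrable
      (fun ω => transferRisk l lam ρ n (linCond Φ (sgdOutput l lam γ Φ T fun t => e t ω))) P ∧
    (∫ ω, transferRisk l lam ρ n (linCond Φ (sgdOutput l lam γ Φ T fun t => e t ω)) ∂P)
        - idealRisk l ρ wstar
      ≤ 2 * R * L * stdVar ρ wstar (linCond Φ (M, b)) / Real.sqrt n
        + L * R * Real.sqrt (K ^ 2 + 1) * frobNorm (M, b) / Real.sqrt T := by
  have H : ConvexLipschitzLoss X Y l L R := ⟨hlmeas, hL, hR, hconv, hlip, hX⟩
  have hn' : (0 : ℝ) < n := by exact_mod_cast hn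
  have hsn := Real.sqrt_pos.2 hn'
  have hlampos : 0 < lam := by rw [hlam]; positivity
  obtain ⟨CQ, hCQ⟩ := exists_norm_linCond_le (d := d) hΦ (M, b)
  have hC : ∀ ω s, ‖linCond Φ (sgdOutput l lam γ Φ T fun t => e t ω) s - linCond Φ (M, b) s‖
      ≤ T * (|γ| * ((K ^ 2 + 1) * (L * R))) + CQ := fun ω s =>
    (norm_sub_le _ _).trans
      (add_le_add (H.norm_linCond_sgdOutput_le hlampos hΦ γ hT _ s) (hCQ s))
  have hint := H.integrable_transferRisk (n := n) hlampos hΦmeas hrisk hideal hvar P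
    (measurable_sgdOutput H hlampos hΦmeas γ hemeas) hC
  refine ⟨fun ω => H.integrable_episodeRisk hlampos hΦmeas hrisk hideal hvar (hC ω), hint, ?_⟩
  obtain ⟨hDint, hDle⟩ := integral_envelopeDiff_sgdOutput_le (ρ := ρ) H hlampos hT hΦmeas hΦ (M, b)
    hγ hemeas heindep helaw
  have hle := integral_mono hint (hDint.add (integrable_const (idealRisk l ρ wstar
      + lam / 2 * stdVar ρ wstar (linCond Φ (M, b)) ^ 2 + 2 * (L * R) ^ 2 / (lam * n)))) fun ω => by
    have h := H.transferRisk_sub_idealRisk_le hlampos hn hΦmeas hrisk hideal hvar (hC ω)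
    rw [Pi.add_apply]
    linarith
  rw [integral_add' hDint (integrable_const _), integral_const, probReal_univ, one_smul] at hle
  -- For the prescribed `λ`, the approximation and stability terms both equal `R L Var / √n`.
  have hconst : lam / 2 * stdVar ρ wstar (linCond Φ (M, b)) ^ 2 + 2 * (L * R) ^ 2 / (lam * n)
      = 2 * R * L * stdVar ρ wstar (linCond Φ (M, b)) / Real.sqrt n := by
    rw [hlam]
    set V := stdVar ρ wstar (linCond Φ (M, b))
    nth_rewrite 3 [← Real.sq_sqrt hn'.le]
    field_simp
    ring
  linarith
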